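/- Conventions. For a non-empty finite set $B\subset\mathbb Z^n$ with $N=\#B-1$, let $X_B\subset\mathbb P^N$ be the Zariski closure of the image of $\phi_B:(\mathbb C^\times)^n\to\mathbb P^N$, $t\mapsto[t^u]_{u\in B}$. A hyperplane $H\subset\mathbb P^N$ is tangent to $X\subset\mathbb P^N$ at $x$ if $H$ contains the embedded tangent space $\mathbb T_xX$. The dual variety $X^*\subset(\mathbb P^N)^\vee$ is the closure of the set of hyperplanes tangent to $X$ at some smooth point of $X$, and the dual defect is $\delta_X=N-1-\dim X^*$, where $\dim\emptyset=-1$. "General" means: outside a proper algebraic subset. Let $0\le r\le n$ and let $A_0,\dots,A_r\subset\mathbb Z^{n-r}$ be finite sets with Cayley sum $$A=A_0*\cdots*A_r:=\bigcup_{i=0}^r A_i\times\{e_i\}\subset\mathbb Z^{n-r}\times\mathbb Z^r,$$ where $e_0=0$ and $e_1,\dots,e_r$ is the standard basis of $\mathbb Z^r$. Assume that $A\neq\emptyset$ and that $A-A$ generates $\mathbb Z^{n-r}\times\mathbb Z^r$. Put $N=\#A-1$, let $X_{i,u}$ ($0\le i\le r$, $u\in A_i$) be the homogeneous coordinates of $\mathbb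 P^N$, and regard $(\mathbb C^\times)^{n-r}\times(\mathbb C^\times)^r$ as a subset of $X_A$ via $\phi_A$ and $(\mathbb C^\times)^r$ as its subtorus $\{1\}\times(\mathbb C^\times)^r$. Let $X^*_{A,1}\subset(\mathbb P^N)^\vee$ be the linear subvariety of hyperplanes tangent to $X_A$ at the unit element of the torus and, for a hyperplane $H$, let $Z^\circ_{A,H}\subset(\mathbb C^\times)^n$ be the set of points of the torus at which $H$ is tangent to $X_A$. Let $V_i=\langle A_i-A_i\rangle_{\mathbb Q}\subset\mathbb Q^{n-r}$, let $K$ be the kernel of $V_0\oplus\cdots\oplus V_r\to\mathbb Q^{n-r}$, $(m_0,\dots,m_r)\mapsto m_0+\cdots+m_r$, and let $$\alpha=\alpha(V_0,\dots,V_r)=\max\{\dim_{\mathbb Q}\langle m_0,\dots,m_r\rangle_{\mathbb Q} : (m_0,\dots,m_r)\in K\}.$$ For $H\in X^*_{A,1}$ with equation $\sum_{i,u}a_{i,u}X_{i,u}=0$ put $m_i=\sum_{u\in A_i}a_{i,u}\,u\in\mathbb C^{n-r}$. Then: (i) $m_i\in(V_i)_{\mathbb C}$ for all $i$, and $(m_0,\dots,m_r)\in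 K_{\mathbb C}$. (ii) If $H$ is general in $X^*_{A,1}$, then $(m_0,\dots,m_r)$ is general in $K_{\mathbb C}$. That is, for every proper algebraic subset $S\subsetneq K_{\mathbb C}$: for general $a$ in the linear space $L$ of coefficient vectors of hyperplanes in $X^*_{A,1}$ (with $0$ included) one has $(m_0,\dots,m_r)\notin S$; and a general $H\in X^*_{A,1}$ has an equation $a$ with $(m_0,\dots,m_r)\notin S$. (iii) $\dim\bigl(Z^\circ_{A,H}\cap(\mathbb C^\times)^r\bigr)=r-\alpha$ for general $H\in X^*_{A,1}$. Moreover $\delta_{X_A}\ge r-\alpha$. (iv) Suppose that there is a surjective group homomorphism $p:\mathbb Z^{n-r}\to\mathbb Z^{n-r-c}$ such that $p(A_0)*\cdots*p(A_r)$ is of join type, i.e. the map $\bigoplus_{i=0}^r\langle p(A_i)-p(A_i)\rangle\to\mathbb Z^{n-r-c}$, $(m_i)_i\mapsto\sum_i m_i$, is injective. Then $\alpha\le c$, and hence $\delta_{X_A}\ge r-c$. -/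

import Mathlib

open scoped Pointwise

noncomputable section

namespace CayleyContact

/-! ### Complex projective space, Zariski closure, dimension -/

/-- The projective space of lines in `ℂ^ι`.  Its points also stand for the hyperplanes of the
projective space: `[a]` is the hyperplane `∑ i, a i * X i = 0`. -/
abbrev ProjSpace (ι : Type) : Type := Projectivization ℂ (ι → ℂ)

/-- The affine cone over a subset of projective space (it always contains the origin). -/
def affineCone {ι : Type} (S : Set (ProjSpace ι)) : Set (ι → ℂ) :=
  {v | ∀ h : v ≠ 0, Projectivization.mk ℂ v h ∈ S}

/-- The (homogeneous) ideal of a subset of projective space: the ideal of its affine cone. -/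
def idealOf {ι : Type} (S : Set (ProjSpace ι)) : Ideal (MvPolynomial ι ℂ) :=
  MvPolynomial.vanishingIdeal ℂ (affineCone S)

/-- Zariski closure in projective space. -/
def zariskiClosure {ι : Type} (S : Set (ProjSpace ι)) : Set (ProjSpace ι) :=
  {P | P.rep ∈ MvPolynomial.zeroLocus ℂ (idealOf S)}

/-- Algebraic subsets of projective space. -/
def IsAlgebraicSet {ι : Type} (S : Set (ProjSpace ι)) : Prop :=
  zariskiClosure S = S

/-- Krull dimension of the homogeneous coordinate ring `ℂ[X] / I(S)`, as a natural number
(see `coe_coneDim`). -/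
def coneDim {ι : Type} (S : Set (ProjSpace ι)) : ℕ :=
  ((ringKrullDim (MvPolynomial ι ℂ ⧸ idealOf S)).unbotD 0).toNat

/-- The dimension of (the Zariski closure of) a subset of projective space; the empty set has
dimension `-1`. -/
def projDim {ι : Type} (S : Set (ProjSpace ι)) : ℤ :=
  (coneDim S : ℤ) - 1

theorem coe_coneDim {ι : Type} [Finite ι] (S : Set (ProjSpace ι)) :
    (coneDim S : WithBot ℕ∞) = ringKrullDim (MvPolynomial ι ℂ ⧸ idealOf S) := by
  have hne : idealOf S ≠ ⊤ := by
    intro h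
    have h1 : (1 : MvPolynomial ι ℂ) ∈ idealOf S := h ▸ Submodule.mem_top
    have h0 : (0 : ι → ℂ) ∈ affineCone S := fun h => absurd rfl h
    simpa using h1 0 h0
  have : Nontrivial (MvPolynomial ι ℂ ⧸ idealOf S) := Ideal.Quotient.nontrivial_iff.2 hne
  have hle := ringKrullDim_quotient_le (idealOf S)
  rw [MvPolynomial.ringKrullDim_of_isNoetherianRing, ringKrullDim_eq_zero_of_field] at hle
  have h0 : (0 : WithBot ℕ∞) ≤ ringKrullDim (MvPolynomial ι ℂ ⧸ idealOf S) :=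
    ringKrullDim_nonneg_of_nontrivial
  unfold coneDim
  generalize ringKrullDim (MvPolynomial ι ℂ ⧸ idealOf S) = x at hle h0
  induction x with
  | bot => simp at h0
  | coe x =>
    have hx : x ≠ ⊤ := by
      rintro rfl
      have h2 : ((⊤ : ℕ∞) : WithBot ℕ∞) ≤ ((Nat.card ι : ℕ∞) : WithBot ℕ∞) := by
        simpa using hle
      exact absurd (WithBot.coe_le_coe.1 h2) (by simp)
    lift x to ℕ using hx
    simp

/-- A property holds for general points of an irreducible `T`: it holds at all points of `T`
outside some algebraic set that does not contain `T` (no condition if `T` is empty). -/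
def HoldsGenerally {ι : Type} (T : Set (ProjSpace ι)) (p : ProjSpace ι → Prop) : Prop :=
  ∃ S : Set (ProjSpace ι), IsAlgebraicSet S ∧ (T.Nonempty → ¬ T ⊆ S) ∧ ∀ H ∈ T, H ∉ S → p H

/-! ### Tangency, dual variety, dual defect -/

/-- The affine cone over the embedded (projective) tangent space of `X` at `P`: the common
zeros of the linear forms `∑ i, (∂F/∂X_i)(P) X_i` for `F ∈ I(X)`. -/
def embTangent {ι : Type} [Fintype ι] (X : Set (ProjSpace ι)) (P : ProjSpace ι) :
    Submodule ℂ (ι → ℂ) where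
  carrier := {v | ∀ F ∈ idealOf X,
    ∑ i, MvPolynomial.eval P.rep (MvPolynomial.pderiv i F) * v i = 0}
  zero_mem' := by intro F _; simp
  add_mem' := by
    intro v w hv hw F hF
    simp [mul_add, Finset.sum_add_distrib, hv F hF, hw F hF]
  smul_mem' := by
    intro c v hv F hF
    have h : ∑ i, MvPolynomial.eval P.rep (MvPolynomial.pderiv i F) * (c • v) i
        = c * ∑ i, MvPolynomial.eval P.rep (MvPolynomial.pderiv i F) * v i := by
      rw [Finset.mul_sum]
      exact Finset.sum_congr rfl fun i _ => by simp only [Pi.smul_apply, smul_eq_mul]; ring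
    rw [h, hv F hF, mul_zero]

/-- The hyperplane `H` is tangent to `X` at `P`: it contains the embedded tangent space. -/
def IsTangentAt {ι : Type} [Fintype ι] (X : Set (ProjSpace ι)) (H P : ProjSpace ι) : Prop :=
  ∀ v ∈ embTangent X P, ∑ i, H.rep i * v i = 0

/-- Smooth points of an irreducible projective variety `X`: points of `X` at which the
embedded tangent space has the dimension of `X`. -/
def IsSmoothPoint {ι : Type} [Fintype ι] (X : Set (ProjSpace ι)) (P : ProjSpace ι) : Prop :=
  P ∈ X ∧ Module.finrank ℂ (embTangent X P) = coneDim X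

/-- The dual variety: closure of the set of hyperplanes tangent to `X` at some smooth point. -/
def dualVariety {ι : Type} [Fintype ι] (X : Set (ProjSpace ι)) : Set (ProjSpace ι) :=
  zariskiClosure {H | ∃ P, IsSmoothPoint X P ∧ IsTangentAt X H P}

/-- The dual defect `N - 1 - dim X^*` of `X ⊆ ℙ^N`, where `N = #ι - 1`. -/
def dualDefect {ι : Type} [Fintype ι] (X : Set (ProjSpace ι)) : ℤ :=
  ((Fintype.card ι : ℤ) - 1) - 1 - projDim (dualVariety X)

/-! ### The toric variety of a finite set of lattice points -/

section Toric

variable {σ : Type} [Fintype σ]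

/-- The vector `(t^u)_{u ∈ A}`, where `t^u = ∏ l, t_l ^ u_l`. -/
def monomialVec (A : Finset (σ → ℤ)) (t : σ → ℂˣ) : A → ℂ :=
  fun u => ((∏ l, t l ^ (u : σ → ℤ) l : ℂˣ) : ℂ)

theorem monomialVec_ne_zero {A : Finset (σ → ℤ)} (hA : A.Nonempty) (t : σ → ℂˣ) :
    monomialVec A t ≠ 0 := by
  obtain ⟨u, hu⟩ := hA
  intro h
  exact (∏ l, t l ^ u l : ℂˣ).ne_zero (congrFun h ⟨u, hu⟩)

/-- The morphism `φ_A : (ℂ^×)^σ → ℙ^N`, `t ↦ [t^u]_{u ∈ A}`. -/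
def torusMap (A : Finset (σ → ℤ)) (hA : A.Nonempty) (t : σ → ℂˣ) : ProjSpace A :=
  Projectivization.mk ℂ (monomialVec A t) (monomialVec_ne_zero hA t)

/-- The toric variety `X_A`: the closure of the image of `φ_A`. -/
def toricVariety (A : Finset (σ → ℤ)) (hA : A.Nonempty) : Set (ProjSpace A) :=
  zariskiClosure (Set.range (torusMap A hA))

/-- `Z°_{A,H}`: the points of the torus at which `H` is tangent to `X_A`. -/
def openContactLocus (A : Finset (σ → ℤ)) (hA : A.Nonempty) (H : ProjSpace A) :
    Set (σ → ℂˣ) :=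
  {t | IsTangentAt (toricVariety A hA) H (torusMap A hA t)}

/-- `X^*_{A,1}`: the hyperplanes tangent to `X_A` at the unit element of the torus. -/
def tangentHyperplanesAtOne (A : Finset (σ → ℤ)) (hA : A.Nonempty) : Set (ProjSpace A) :=
  {H | IsTangentAt (toricVariety A hA) H (torusMap A hA 1)}

end Toric

/-! ### Cayley sums -/

/-- The point `(u, e_i) ∈ ℤ^d × ℤ^r`, where `e_0 = 0` and `e_1, …, e_r` is the standard basis. -/
def cayleyPoint {d r : ℕ} (i : Fin (r + 1)) (u : Fin d → ℤ) : Fin d ⊕ Fin r → ℤ :=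
  Sum.elim u (fun l => if i = l.succ then 1 else 0)

/-- The Cayley sum `A_0 * ⋯ * A_r ⊆ ℤ^d × ℤ^r`. -/
def cayleySum {d r : ℕ} (A : Fin (r + 1) → Finset (Fin d → ℤ)) :
    Finset (Fin d ⊕ Fin r → ℤ) :=
  Finset.univ.biUnion fun i => (A i).image (cayleyPoint i)

theorem cayleyPoint_mem {d r : ℕ} (A : Fin (r + 1) → Finset (Fin d → ℤ)) (i : Fin (r + 1))
    (u : A i) : cayleyPoint i (u : Fin d → ℤ) ∈ cayleySum A :=
  Finset.mem_biUnion.2 ⟨i, Finset.mem_univ i, Finset.mem_image_of_mem _ u.2⟩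

/-- The Cayley sum of the `A_i` is of join type: the sum of the groups `⟨A_i - A_i⟩` is direct. -/
def IsJoinType {d r : ℕ} (A : Fin (r + 1) → Finset (Fin d → ℤ)) : Prop :=
  Function.Injective
    (fun m : (i : Fin (r + 1)) →
        AddSubgroup.closure ((A i : Set (Fin d → ℤ)) - (A i : Set (Fin d → ℤ))) =>
      ∑ i, (m i : Fin d → ℤ))

/-- `m_i = ∑_{u ∈ A_i} a_{(u, e_i)} u ∈ ℂ^d`, for a coefficient vector `a` of a linear form. -/
def moments {d r : ℕ} (A : Fin (r + 1) → Finset (Fin d → ℤ)) (a : cayleySum A → ℂ) :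
    Fin (r + 1) → Fin d → ℂ :=
  fun i l => ∑ u : A i,
    a ⟨cayleyPoint i (u : Fin d → ℤ), cayleyPoint_mem A i u⟩ * (((u : Fin d → ℤ) l : ℤ) : ℂ)

/-! ### The invariant `α` -/

/-- The kernel of `V_0 ⊕ ⋯ ⊕ V_r → V`, as a subspace of `V^{r+1}`. -/
def sumKernel {k V : Type} [Field k] [AddCommGroup V] [Module k V] {r : ℕ}
    (W : Fin (r + 1) → Submodule k V) : Submodule k (Fin (r + 1) → V) where
  carrier := {m | (∀ i, m i ∈ W i) ∧ ∑ i, m i = 0}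
  zero_mem' := ⟨fun i => (W i).zero_mem, by simp⟩
  add_mem' := by
    rintro m m' ⟨h, hs⟩ ⟨h', hs'⟩
    exact ⟨fun i => (W i).add_mem (h i) (h' i), by simp [Finset.sum_add_distrib, hs, hs']⟩
  smul_mem' := by
    rintro c m ⟨h, hs⟩
    exact ⟨fun i => (W i).smul_mem c (h i), by simp [← Finset.smul_sum, hs]⟩

/-- `α(V_0, …, V_r)`: the maximum of `dim ⟨m_0, …, m_r⟩` over the kernel (these dimensions are
at most `r`). -/
def alphaInv {k V : Type} [Field k] [AddCommGroup V] [Module k V] {r : ℕ}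
    (W : Fin (r + 1) → Submodule k V) : ℕ :=
  sSup {s | ∃ m ∈ sumKernel W, s = Module.finrank k (Submodule.span k (Set.range m))}

/-- `V_i = ⟨A_i - A_i⟩_ℚ ⊆ ℚ^d`. -/
def diffSpan {d : ℕ} (B : Finset (Fin d → ℤ)) : Submodule ℚ (Fin d → ℚ) :=
  Submodule.span ℚ {w | ∃ u ∈ B, ∃ v ∈ B, w = fun l => ((u l - v l : ℤ) : ℚ)}

/-- `W_ℂ ⊆ ℂ^d` for a subspace `W ⊆ ℚ^d`. -/
def complexify {d : ℕ} (W : Submodule ℚ (Fin d → ℚ)) : Submodule ℂ (Fin d → ℂ) :=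
  Submodule.span ℂ ((fun w l => ((w l : ℚ) : ℂ)) '' (W : Set (Fin d → ℚ)))

/-- `K_ℂ ⊆ (ℂ^d)^{r+1}` for a subspace `K ⊆ (ℚ^d)^{r+1}`. -/
def complexifyTuple {d r : ℕ} (K : Submodule ℚ (Fin (r + 1) → Fin d → ℚ)) :
    Submodule ℂ (Fin (r + 1) → Fin d → ℂ) :=
  Submodule.span ℂ ((fun m i l => ((m i l : ℚ) : ℂ)) '' (K : Set (Fin (r + 1) → Fin d → ℚ)))

/-- The algebraic subset of `(ℂ^d)^{r+1}` defined by an ideal. -/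
def tupleZeroLocus {d r : ℕ} (I : Ideal (MvPolynomial (Fin (r + 1) × Fin d) ℂ)) :
    Set (Fin (r + 1) → Fin d → ℂ) :=
  {m | (fun q : Fin (r + 1) × Fin d => m q.1 q.2) ∈ MvPolynomial.zeroLocus ℂ I}

end CayleyContact

end

open scoped Pointwise

noncomputable section

namespace CayleyContact

/-! ### Krull dimension of images of polynomial maps -/

/-! Everything reduces to linear algebra on one space. At a torus point `t`, the tangent space of
the cone over `X_A` is spanned by the vectors `t^b` and `t^b b_l`. It contains them because they are
velocities of curves in the cone, and the gradients of the binomials in the ideal allow nothing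
more. Hence `[a]` is tangent at `t` iff `(a_b t^b)_b` lies in the linear space `L = tangentSystem
A`, cut out by two conditions: each block of coordinates sums to zero, and the moments `m_i` sum to
zero (`forall_embTangent_iff`, `mem_tangentSystem_iff`).

The moments map `L` onto `K_ℂ` (`moments_mem_momentKernel`, `exists_moments_eq`). This gives (i),
and (ii) follows by pulling polynomials back.

A point of the fibre torus multiplies block `i` by a scalar `s_i`. Block sums stay zero, so tangency
becomes `∑ s_i m_i = 0`. The contact locus in the fibre is thus the torus part of the
projectivization of a linear space of dimension `r + 1 - rank(m)`, and it is non-empty because it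
contains the unit. The generic rank over `K_ℂ` is `α`, since rational points are Zariski dense
(`card_le_alphaInv`, `exists_generic_minor`).

The bound on the defect is a direct parameter count. Up to closure, tangent hyperplanes are torus
translates of `L`. Fibre translations that keep the hyperplane in `L` are redundant, so `α` fibre
coordinates suffice (`eval_baseChar_blockScale_eq_zero`). The cone over the dual variety therefore
has dimension at most `d + α + dim L`, where `dim L = #A - (d + r + 1)`.

For (iv), clear denominators in an element of `K`. Join type forces every `p(m_i)` to vanish, so all
`m_i` lie in the `c`-dimensional kernel of `p` over `ℚ`. -/

theorem ringKrullDim_le_of_isIntegral {R S : Type*} [CommRing R] [CommRing S] (g : R →+* S)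
    (hg : g.IsIntegral) : ringKrullDim S ≤ ringKrullDim R := by
  algebraize [g]
  have : Algebra.IsIntegral R S := ⟨hg⟩
  refine Order.krullDim_le_of_strictMono (PrimeSpectrum.comap g) fun p q hpq => ?_
  exact Ideal.IsIntegral.comap_lt_comap (R := R) (show p.asIdeal < q.asIdeal from hpq)

/-- The coordinate ring of the closure of the image of a polynomial map from an affine space of
dimension `p` has dimension at most `p`. -/
theorem ringKrullDim_quotient_ker_le {ι τ : Type} [Finite ι] [Fintype τ]
    (f : MvPolynomial ι ℂ →ₐ[ℂ] MvPolynomial τ ℂ) :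
    ringKrullDim (MvPolynomial ι ℂ ⧸ RingHom.ker f) ≤ Fintype.card τ := by
  have : Nontrivial (MvPolynomial ι ℂ ⧸ RingHom.ker f) :=
    Ideal.Quotient.nontrivial_iff.2 (RingHom.ker_ne_top f)
  -- Noether normalization: the quotient is integral over a polynomial ring in `s` variables, which
  -- embeds in the target of `f`; transcendence degree then bounds `s`.
  obtain ⟨s, g, hinj, hint⟩ :=
    exists_integral_inj_algHom_of_fg ℂ (MvPolynomial ι ℂ ⧸ RingHom.ker f)
  have h1 := ringKrullDim_le_of_isIntegral g.toRingHom hint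
  rw [MvPolynomial.ringKrullDim_of_isNoetherianRing, ringKrullDim_eq_zero_of_field] at h1
  have h2 := trdeg_le_of_injective ((Ideal.kerLiftAlg f).comp g)
    ((Ideal.kerLiftAlg_injective f).comp hinj)
  rw [MvPolynomial.trdeg_of_isDomain, MvPolynomial.trdeg_of_isDomain] at h2
  simp only [Cardinal.lift_natCast, Cardinal.mk_fintype, Nat.cast_le] at h2
  refine h1.trans ?_
  simpa using h2

/-! ### Pulling back polynomials along linear maps -/

section Pullback

variable {ι κ : Type} [Fintype κ] [DecidableEq κ]

theorem linearMap_apply_eq_sum {k M : Type*} [CommSemiring k] [AddCommMonoid M] [Module k M]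
    (f : (κ → k) →ₗ[k] M) (x : κ → k) : f x = ∑ i, x i • f (Pi.single i 1) := by
  conv_lhs => rw [← Finset.univ_sum_single x, map_sum]
  refine Finset.sum_congr rfl fun i _ => ?_
  rw [← map_smul, ← Pi.single_smul, smul_eq_mul, mul_one]

/-- The polynomial `F ∘ ψ` for a linear map `ψ`. -/
def linearPullback (ψ : (κ → ℂ) →ₗ[ℂ] (ι → ℂ)) : MvPolynomial ι ℂ →ₐ[ℂ] MvPolynomial κ ℂ :=
  MvPolynomial.aeval fun i => ∑ j, MvPolynomial.C (ψ (Pi.single j 1) i) * MvPolynomial.X j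

theorem eval_linearPullback_X (ψ : (κ → ℂ) →ₗ[ℂ] (ι → ℂ)) (y : κ → ℂ) (i : ι) :
    MvPolynomial.eval y (∑ j, MvPolynomial.C (ψ (Pi.single j 1) i) * MvPolynomial.X j) =
      ψ y i := by
  rw [linearMap_apply_eq_sum ψ y]
  simp [mul_comm]

theorem eval_aeval {κ : Type} (q : ι → MvPolynomial κ ℂ) (F : MvPolynomial ι ℂ) (y : κ → ℂ) :
    MvPolynomial.eval y (MvPolynomial.aeval q F) =
      MvPolynomial.eval (fun i => MvPolynomial.eval y (q i)) F := by
  induction F using MvPolynomial.induction_on with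
  | C a => simp
  | add p q hp hq => rw [map_add, map_add, map_add, hp, hq]
  | mul_X p i hp => rw [map_mul, map_mul, map_mul, hp, MvPolynomial.aeval_X, MvPolynomial.eval_X]

theorem eval_linearPullback (ψ : (κ → ℂ) →ₗ[ℂ] (ι → ℂ)) (F : MvPolynomial ι ℂ) (y : κ → ℂ) :
    MvPolynomial.eval y (linearPullback ψ F) = MvPolynomial.eval (ψ y) F := by
  rw [linearPullback, eval_aeval]
  simp only [eval_linearPullback_X]

/-- With a linear left inverse `g` of `ψ`, every `F` equals `(F ∘ g) ∘ ψ`. -/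
theorem linearPullback_surjective [Fintype ι] [DecidableEq ι] (ψ : (κ → ℂ) →ₗ[ℂ] (ι → ℂ))
    (hψ : Function.Injective ψ) : Function.Surjective (linearPullback ψ) := by
  obtain ⟨g, hg⟩ := LinearMap.exists_leftInverse_of_injective ψ (LinearMap.ker_eq_bot.2 hψ)
  intro F
  refine ⟨linearPullback g F, MvPolynomial.funext fun y => ?_⟩
  rw [eval_linearPullback, eval_linearPullback]
  congr 1
  exact congrArg _ (LinearMap.congr_fun hg y)

end Pullback

/-- If a nonzero polynomial times `F` vanishes everywhere then so does `F`. -/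
theorem eval_eq_zero_of_mul {κ : Type} {F G : MvPolynomial κ ℂ} (y₀ : κ → ℂ)
    (hG : MvPolynomial.eval y₀ G ≠ 0)
    (h : ∀ y, MvPolynomial.eval y G ≠ 0 → MvPolynomial.eval y F = 0) : F = 0 := by
  have h1 : G * F = 0 := MvPolynomial.funext fun y => by
    by_cases hy : MvPolynomial.eval y G = 0 <;> simp_all
  rcases mul_eq_zero.1 h1 with h2 | h2
  · simp [h2] at hG
  · exact h2

/-! ### Ideals and closures in projective space -/

section Proj

variable {ι : Type}

theorem mem_idealOf {S : Set (ProjSpace ι)} {F : MvPolynomial ι ℂ} :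
    F ∈ idealOf S ↔ ∀ v ∈ affineCone S, MvPolynomial.eval v F = 0 := Iff.rfl

theorem mem_zariskiClosure {S : Set (ProjSpace ι)} {P : ProjSpace ι} :
    P ∈ zariskiClosure S ↔ ∀ F ∈ idealOf S, MvPolynomial.eval P.rep F = 0 := Iff.rfl

theorem exists_smul_rep (v : ι → ℂ) (hv : v ≠ 0) :
    ∃ c : ℂ, c ≠ 0 ∧ v = c • (Projectivization.mk ℂ v hv).rep := by
  obtain ⟨a, ha⟩ := Projectivization.exists_smul_eq_mk_rep ℂ v hv
  refine ⟨(a⁻¹ : ℂˣ), Units.ne_zero _, ?_⟩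
  rw [← ha, Units.smul_def, smul_smul]
  simp

theorem mk_smul_eq {v : ι → ℂ} (hv : v ≠ 0) {c : ℂ} (hcv : c • v ≠ 0) :
    Projectivization.mk ℂ (c • v) hcv = Projectivization.mk ℂ v hv :=
  (Projectivization.mk_eq_mk_iff' ℂ _ _ _ _).2 ⟨c, rfl⟩

theorem zero_mem_affineCone (S : Set (ProjSpace ι)) : (0 : ι → ℂ) ∈ affineCone S :=
  fun h => absurd rfl h

theorem rep_mem_affineCone {S : Set (ProjSpace ι)} {P : ProjSpace ι} (h : P ∈ S) :
    P.rep ∈ affineCone S := fun _ => by rwa [Projectivization.mk_rep]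

theorem smul_mem_affineCone {S : Set (ProjSpace ι)} {v : ι → ℂ} (hv : v ∈ affineCone S) (c : ℂ) :
    c • v ∈ affineCone S := by
  intro h
  have hv0 : v ≠ 0 := by rintro rfl; simp at h
  rw [mk_smul_eq hv0]
  exact hv hv0

theorem subset_zariskiClosure (S : Set (ProjSpace ι)) : S ⊆ zariskiClosure S :=
  fun _ hP _ hF => hF _ (rep_mem_affineCone hP)

/-- The polynomial `F(cX)`. -/
def scalePoly (c : ℂ) (F : MvPolynomial ι ℂ) : MvPolynomial ι ℂ :=
  MvPolynomial.aeval (fun i => MvPolynomial.C c * MvPolynomial.X i) F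

theorem eval_scalePoly (c : ℂ) (F : MvPolynomial ι ℂ) (v : ι → ℂ) :
    MvPolynomial.eval v (scalePoly c F) = MvPolynomial.eval (c • v) F := by
  rw [scalePoly, eval_aeval]
  congr 2
  ext i
  simp

/-- Stability under `X ↦ cX` takes the place of homogeneity of the ideal and makes later definitions
independent of the representative of a point. -/
theorem scalePoly_mem {S : Set (ProjSpace ι)} {F : MvPolynomial ι ℂ} (hF : F ∈ idealOf S)
    (c : ℂ) : scalePoly c F ∈ idealOf S := by
  rw [mem_idealOf] at hF ⊢
  intro v hv
  rw [eval_scalePoly]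
  exact hF _ (smul_mem_affineCone hv c)

theorem idealOf_zariskiClosure (S : Set (ProjSpace ι)) :
    idealOf (zariskiClosure S) = idealOf S := by
  apply le_antisymm
  · intro F hF
    rw [mem_idealOf] at hF ⊢
    exact fun v hv => hF v fun h => subset_zariskiClosure S (hv h)
  · intro F hF
    rw [mem_idealOf]
    intro v hv
    by_cases h0 : v = 0
    · subst h0
      exact hF _ (zero_mem_affineCone S)
    · obtain ⟨c, -, hc⟩ := exists_smul_rep v h0
      rw [hc, ← eval_scalePoly]
      exact hv h0 _ (scalePoly_mem hF c)

/-- Points at which a polynomial vanishes along the whole corresponding line. -/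
def lineZeroLocus (G : MvPolynomial ι ℂ) : Set (ProjSpace ι) :=
  {P | ∀ c : ℂ, MvPolynomial.eval (c • P.rep) G = 0}

theorem mk_mem_lineZeroLocus {G : MvPolynomial ι ℂ} {v : ι → ℂ} (hv : v ≠ 0) :
    Projectivization.mk ℂ v hv ∈ lineZeroLocus G ↔ ∀ c : ℂ, MvPolynomial.eval (c • v) G = 0 := by
  obtain ⟨a, ha, h⟩ := exists_smul_rep v hv
  set P := Projectivization.mk ℂ v hv
  constructor
  · intro hP c
    rw [h, smul_smul]
    exact hP _
  · intro hc c
    have := hc (c * a⁻¹)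
    rwa [h, smul_smul, inv_mul_cancel_right₀ ha] at this

theorem exists_ne_zero_apply {v : ι → ℂ} (hv : v ≠ 0) : ∃ i, v i ≠ 0 := by
  by_contra! h
  exact hv (funext h)

theorem isAlgebraicSet_lineZeroLocus (G : MvPolynomial ι ℂ) :
    IsAlgebraicSet (lineZeroLocus G) := by
  refine subset_antisymm (fun P hP c => ?_) (subset_zariskiClosure _)
  obtain ⟨i, hi⟩ := exists_ne_zero_apply P.rep_nonzero
  -- The factor `X i` forces vanishing at the origin, which lies in every affine cone although `G`
  -- may be nonzero there. Since `P.rep i ≠ 0`, it cancels at the end.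
  have h1 : MvPolynomial.X i * scalePoly c G ∈ idealOf (lineZeroLocus G) := by
    rw [mem_idealOf]
    intro v hv
    by_cases h0 : v = 0
    · simp [h0]
    · rw [map_mul, eval_scalePoly, (mk_mem_lineZeroLocus h0).1 (hv h0) c, mul_zero]
  have h2 := mem_zariskiClosure.1 hP _ h1
  rw [map_mul, eval_scalePoly, MvPolynomial.eval_X] at h2
  exact (mul_eq_zero.1 h2).resolve_left hi

/-- A polynomial nonzero somewhere on a line through the origin is nonzero at some point of the
line other than the origin. -/
theorem exists_ne_zero_eval_smul {G : MvPolynomial ι ℂ} {v : ι → ℂ}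
    (h : ∃ c : ℂ, MvPolynomial.eval (c • v) G ≠ 0) :
    ∃ c : ℂ, c ≠ 0 ∧ MvPolynomial.eval (c • v) G ≠ 0 := by
  obtain ⟨c₀, hc₀⟩ := h
  by_contra! hc
  let F : MvPolynomial Unit ℂ :=
    MvPolynomial.aeval (fun i => MvPolynomial.C (v i) * MvPolynomial.X ()) G
  have hF : ∀ y, MvPolynomial.eval y F = MvPolynomial.eval (y () • v) G := fun y => by
    rw [eval_aeval]
    congr 2
    ext i
    simp [mul_comm]
  have h0 : F = 0 := eval_eq_zero_of_mul (G := MvPolynomial.X ()) (fun _ => 1) (by simp)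
    fun y hy => by rw [hF]; exact hc _ (by simpa using hy)
  apply hc₀
  have := hF fun _ => c₀
  rw [h0, map_zero] at this
  exact this.symm

end Proj

/-! ### Dimension of linear parametrizations -/

theorem coneDim_eq_of_linear {ι : Type} [Fintype ι] [DecidableEq ι] {k : ℕ} (S : Set (ProjSpace ι))
    (ψ : (Fin k → ℂ) →ₗ[ℂ] (ι → ℂ)) (hψ : Function.Injective ψ)
    (hS : ∀ F, F ∈ idealOf S ↔ linearPullback ψ F = 0) : coneDim S = k := by
  have h1 : idealOf S = RingHom.ker (linearPullback ψ) := Ideal.ext fun F => hS F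
  have h2 := coe_coneDim S
  rw [h1, ringKrullDim_eq_of_ringEquiv
    (Ideal.quotientKerAlgEquivOfSurjective (linearPullback_surjective ψ hψ)).toRingEquiv,
    MvPolynomial.ringKrullDim_of_isNoetherianRing, ringKrullDim_eq_zero_of_field] at h2
  have h3 : ((coneDim S : ℕ∞) : WithBot ℕ∞) = ((k : ℕ∞) : WithBot ℕ∞) := by simpa using h2
  exact_mod_cast WithBot.coe_injective h3

/-- Geometrically, the cone over `S` lies in the closure of the image of the polynomial map dual to
`f`. -/
theorem coneDim_le_of_ker_le {ι τ : Type} [Fintype ι] [Fintype τ] (S : Set (ProjSpace ι))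
    (f : MvPolynomial ι ℂ →ₐ[ℂ] MvPolynomial τ ℂ) (h : RingHom.ker f ≤ idealOf S) :
    coneDim S ≤ Fintype.card τ := by
  have h1 := ringKrullDim_le_of_surjective _ (Ideal.Quotient.factor_surjective h)
  have h2 : ((coneDim S : ℕ∞) : WithBot ℕ∞) ≤ ((Fintype.card τ : ℕ∞) : WithBot ℕ∞) :=
    (coe_coneDim S).trans_le (h1.trans (ringKrullDim_quotient_ker_le f))
  exact_mod_cast WithBot.coe_le_coe.1 h2

/-! ### Gradients and tangent spaces -/

section Tangent

variable {ι : Type} [Fintype ι]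

theorem hasDerivAt_eval_comp (F : MvPolynomial ι ℂ) (γ : ℂ → ι → ℂ) (γ' : ι → ℂ) (x : ℂ)
    (hγ : ∀ i, HasDerivAt (fun y => γ y i) (γ' i) x) :
    HasDerivAt (fun y => MvPolynomial.eval (γ y) F)
      (∑ i, MvPolynomial.eval (γ x) (MvPolynomial.pderiv i F) * γ' i) x := by
  induction F using MvPolynomial.induction_on with
  | C a => simpa using hasDerivAt_const x a
  | add p q hp hq =>
    simp only [map_add, add_mul, Finset.sum_add_distrib]
    exact hp.add hq
  | mul_X p j hp =>
    simp only [map_mul, MvPolynomial.eval_X]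
    convert! hp.mul (hγ j) using 1
    simp only [Derivation.leibniz, smul_eq_mul, map_add, map_mul,
      MvPolynomial.eval_X, add_mul, Finset.sum_add_distrib]
    rw [add_comm, Finset.sum_mul]
    congr 1
    · exact Finset.sum_congr rfl fun i _ => by ring
    · classical
      rw [Finset.sum_eq_single j]
      · simp
      · intro b _ hb
        simp [hb.symm]
      · simp

/-- The gradient of `F` at `p` applied to `v`. -/
def gradPair (F : MvPolynomial ι ℂ) (p v : ι → ℂ) : ℂ :=
  ∑ i, MvPolynomial.eval p (MvPolynomial.pderiv i F) * v i

theorem gradPair_scalePoly (c : ℂ) (F : MvPolynomial ι ℂ) (p v : ι → ℂ) :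
    gradPair (scalePoly c F) p v = c * gradPair F (c • p) v := by
  have h1 := hasDerivAt_eval_comp (scalePoly c F) (fun y => p + y • v) v 0 fun i => by
    simpa using ((hasDerivAt_id (0 : ℂ)).mul_const (v i)).const_add (p i)
  have h2 := hasDerivAt_eval_comp F (fun y => c • (p + y • v)) (c • v) 0 fun i => by
    simpa using (((hasDerivAt_id (0 : ℂ)).mul_const (v i)).const_add (p i)).const_mul c
  simp only [eval_scalePoly] at h1
  have h3 := h1.unique h2
  simp only [zero_smul, add_zero, Pi.smul_apply, smul_eq_mul] at h3
  rw [gradPair, h3, gradPair, Finset.mul_sum]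
  exact Finset.sum_congr rfl fun i _ => by ring

theorem mem_embTangent_mk (X : Set (ProjSpace ι)) (p : ι → ℂ) (hp : p ≠ 0) (v : ι → ℂ) :
    v ∈ embTangent X (Projectivization.mk ℂ p hp) ↔ ∀ F ∈ idealOf X, gradPair F p v = 0 := by
  obtain ⟨c, hc, h⟩ := exists_smul_rep p hp
  set P := Projectivization.mk ℂ p hp
  have key : v ∈ embTangent X P ↔ ∀ F ∈ idealOf X, gradPair F P.rep v = 0 := Iff.rfl
  rw [key]
  constructor
  · intro H F hF
    have h1 := H _ (scalePoly_mem hF c)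
    rw [gradPair_scalePoly, ← h] at h1
    exact (mul_eq_zero.1 h1).resolve_left hc
  · intro H F hF
    have h1 := H _ (scalePoly_mem hF c⁻¹)
    rw [gradPair_scalePoly, h, smul_smul, inv_mul_cancel₀ hc, one_smul] at h1
    exact (mul_eq_zero.1 h1).resolve_left (inv_ne_zero hc)

theorem isTangentAt_mk (X : Set (ProjSpace ι)) (a : ι → ℂ) (ha : a ≠ 0) (P : ProjSpace ι) :
    IsTangentAt X (Projectivization.mk ℂ a ha) P ↔ ∀ v ∈ embTangent X P, ∑ i, a i * v i = 0 := by
  obtain ⟨c, hc, h⟩ := exists_smul_rep a ha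
  set H := Projectivization.mk ℂ a ha
  have key : ∀ v : ι → ℂ, ∑ i, a i * v i = c * ∑ i, H.rep i * v i := fun v => by
    conv_lhs => rw [h]
    rw [Finset.mul_sum]
    exact Finset.sum_congr rfl fun i _ => by simp [mul_assoc]
  refine forall₂_congr fun v _ => ?_
  rw [key, mul_eq_zero, or_iff_right hc]

/-- A linear form vanishing on the tangent space is the gradient of an element of the ideal. -/
theorem exists_grad_eq (X : Set (ProjSpace ι)) (P : ProjSpace ι) (a : ι → ℂ)
    (ha : ∀ v ∈ embTangent X P, ∑ i, a i * v i = 0) :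
    ∃ F ∈ idealOf X, ∀ i, a i = MvPolynomial.eval P.rep (MvPolynomial.pderiv i F) := by
  classical
  let N : Submodule ℂ (ι → ℂ) :=
    { carrier := {b | ∃ F ∈ idealOf X, ∀ i, b i = MvPolynomial.eval P.rep (MvPolynomial.pderiv i F)}
      zero_mem' := ⟨0, zero_mem _, by simp⟩
      add_mem' := by
        rintro b b' ⟨F, hF, h⟩ ⟨F', hF', h'⟩
        exact ⟨F + F', add_mem hF hF', fun i => by simp [h, h']⟩
      smul_mem' := by
        rintro c b ⟨F, hF, h⟩
        exact ⟨c • F, Submodule.smul_of_tower_mem _ c hF, fun i => by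
          simp [h, MvPolynomial.smul_eval]⟩ }
  -- The gradients form a subspace `N`. A functional separating `a` from `N` is pairing with a
  -- vector that all gradients kill, that is, with a tangent vector not killed by `a`.
  by_contra hN
  obtain ⟨f, hfa, hf⟩ := Submodule.exists_le_ker_of_notMem (p := N) (v := a) hN
  have hfv : ∀ b : ι → ℂ, f b = ∑ i, b i * f (Pi.single i 1) := fun b => by
    simpa using linearMap_apply_eq_sum f b
  apply hfa
  rw [hfv]
  refine ha _ fun F hF => ?_
  have : (fun i => MvPolynomial.eval P.rep (MvPolynomial.pderiv i F)) ∈ N := ⟨F, hF, fun _ => rfl⟩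
  have := hf this
  rwa [LinearMap.mem_ker, hfv] at this

end Tangent

/-! ### Rational linear systems over the complex numbers -/

section Rational

variable {β τ : Type} [Fintype β] [Fintype τ]

/-- A complex vector orthogonal to all integer relations among integer vectors `g b` is a
linear function of the `g b`. -/
theorem exists_eq_sum_of_forall_relation (g : β → τ → ℤ) (w : β → ℂ)
    (h : ∀ c : β → ℤ, (∀ l, ∑ b, c b * g b l = 0) → ∑ b, (c b : ℂ) * w b = 0) :
    ∃ μ : τ → ℂ, ∀ b, w b = ∑ l, μ l * (g b l : ℂ) := by
  classical
  let f : (β → ℚ) →ₗ[ℚ] (τ → ℚ) := Fintype.linearCombination ℚ fun b l => (g b l : ℚ)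
  let w' : (β → ℚ) →ₗ[ℚ] ℂ := Fintype.linearCombination ℚ w
  have hker : ∀ q, f q = 0 → w' q = 0 := by
    intro q hq
    -- A rational relation becomes an integer one after clearing denominators, so the hypothesis
    -- applies to it.
    obtain ⟨⟨D, hD⟩, hDq⟩ := IsLocalization.exist_integer_multiples_of_finite (nonZeroDivisors ℤ) q
    have hD0 : (D : ℂ) ≠ 0 := by exact_mod_cast nonZeroDivisors.ne_zero hD
    choose c hc using hDq
    have hc' : ∀ b, (c b : ℚ) = D * q b := fun b => by
      have := hc b
      simpa [Algebra.smul_def] using this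
    have h1 := h c fun l => by
      have h2 : ∑ b, q b * (g b l : ℚ) = 0 := by
        simpa [f, Fintype.linearCombination_apply] using congrFun hq l
      have h3 : ((∑ b, c b * g b l : ℤ) : ℚ) = 0 := by
        push_cast
        simp only [hc', mul_assoc]
        rw [← Finset.mul_sum, h2, mul_zero]
      exact_mod_cast h3
    have hc'' : ∀ b, (c b : ℂ) = D * (q b : ℂ) := fun b => by
      exact_mod_cast congrArg (Rat.cast (K := ℂ)) (hc' b)
    simp only [hc'', mul_assoc] at h1
    rw [← Finset.mul_sum, mul_eq_zero, or_iff_right hD0] at h1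
    simpa [w', Fintype.linearCombination_apply, Rat.smul_def] using h1
  -- As `w'` kills the kernel of `f`, it factors through the range of `f`; the induced functional is
  -- `w' ∘ s`, and its extension `k` supplies `μ`.
  obtain ⟨s, hs⟩ := LinearMap.exists_rightInverse_of_surjective f.rangeRestrict f.range_rangeRestrict
  obtain ⟨k, hk⟩ := LinearMap.exists_extend (w'.comp s)
  refine ⟨fun l => k (Pi.single l 1), fun b => ?_⟩
  have h1 : k (f (Pi.single b 1)) = w' (Pi.single b 1) := by
    have h2 := LinearMap.congr_fun hk (f.rangeRestrict (Pi.single b 1))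
    have h3 := LinearMap.congr_fun hs (f.rangeRestrict (Pi.single b 1))
    have h4 := hker (s (f.rangeRestrict (Pi.single b 1)) - Pi.single b 1) (by
      rw [map_sub, sub_eq_zero]
      exact congrArg Subtype.val h3)
    rw [map_sub, sub_eq_zero] at h4
    rw [← h4]
    exact h2
  have h5 : w' (Pi.single b 1) = w b := by simp [w']
  have h6 : f (Pi.single b 1) = fun l => (g b l : ℚ) := by simp [f]
  rw [← h5, ← h1, h6, linearMap_apply_eq_sum k]
  simp [Rat.smul_def, mul_comm]

/-- The complex solutions of a homogeneous integer linear system are spanned by the rational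
solutions. -/
theorem mem_span_rational_solutions (g : β → τ → ℤ) (a : β → ℂ)
    (ha : ∀ l, ∑ b, a b * (g b l : ℂ) = 0) :
    a ∈ Submodule.span ℂ ((fun (q : β → ℚ) b => (q b : ℂ)) ''
      {q | ∀ l, ∑ b, q b * (g b l : ℚ) = 0}) := by
  classical
  by_contra hN
  obtain ⟨f, hfa, hf⟩ := Submodule.exists_le_ker_of_notMem hN
  -- A functional killing the rational solutions is a combination of the equations of the system,
  -- hence kills the complex solution `a` too.
  obtain ⟨μ, hμ⟩ := exists_eq_sum_of_forall_relation g (fun b => f (Pi.single b 1)) fun c hc => by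
    have h1 : f (fun b => (c b : ℂ)) = 0 := by
      refine hf (Submodule.subset_span ⟨fun b => (c b : ℚ), fun l => ?_, ?_⟩)
      · have := congrArg (Int.cast (R := ℚ)) (hc l)
        simpa using this
      · ext b
        simp
    rw [linearMap_apply_eq_sum f] at h1
    simpa using h1
  apply hfa
  rw [linearMap_apply_eq_sum f]
  simp only [hμ, smul_eq_mul, Finset.mul_sum]
  rw [Finset.sum_comm]
  refine Finset.sum_eq_zero fun l _ => ?_
  have h2 : ∑ b, a b * (μ l * (g b l : ℂ)) = μ l * ∑ b, a b * (g b l : ℂ) := by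
    rw [Finset.mul_sum]
    exact Finset.sum_congr rfl fun b _ => by ring
  rw [h2, ha, mul_zero]

end Rational

/-! ### The tangent spaces of a toric variety at points of the torus -/

section ToricTangent

/-- The binomial attached to an integer vector. -/
def binomial {ι : Type} [Fintype ι] (c : ι → ℤ) : MvPolynomial ι ℂ :=
  MvPolynomial.monomial (Finsupp.equivFunOnFinite.symm fun u => (c u).toNat) 1 -
    MvPolynomial.monomial (Finsupp.equivFunOnFinite.symm fun u => (-c u).toNat) 1

theorem eval_monomial_equivFun {ι : Type} [Fintype ι] (s : ι → ℕ) (v : ι → ℂ) :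
    MvPolynomial.eval v (MvPolynomial.monomial (Finsupp.equivFunOnFinite.symm s) 1) =
      ∏ u, v u ^ s u := by
  rw [MvPolynomial.eval_monomial, Finsupp.prod_fintype _ _ (by simp)]
  simp

theorem gradPair_monomial {ι : Type} [Fintype ι] (s : ι → ℕ) (p w : ι → ℂ) :
    gradPair (MvPolynomial.monomial (Finsupp.equivFunOnFinite.symm s) 1) p (fun u => p u * w u) =
      (∏ u, p u ^ s u) * ∑ u, (s u : ℂ) * w u := by
  rw [gradPair, Finset.mul_sum]
  refine Finset.sum_congr rfl fun u _ => ?_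
  have h := congrArg (MvPolynomial.eval p) (MvPolynomial.X_mul_pderiv_monomial (R := ℂ) (i := u)
    (m := Finsupp.equivFunOnFinite.symm s) (r := 1))
  rw [map_mul, MvPolynomial.eval_X, map_nsmul, eval_monomial_equivFun] at h
  rw [← mul_assoc, mul_comm _ (p u), h]
  simp [nsmul_eq_mul]
  ring

variable {σ : Type} [Fintype σ] {B : Finset (σ → ℤ)}

theorem monomialVec_apply_ne_zero (t : σ → ℂˣ) (u : B) : monomialVec B t u ≠ 0 :=
  Units.ne_zero _

theorem monomialVec_mul (t s : σ → ℂˣ) (u : B) :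
    monomialVec B (t * s) u = monomialVec B t u * monomialVec B s u := by
  simp [monomialVec, mul_zpow, Finset.prod_mul_distrib]

theorem monomialVec_one (u : B) : monomialVec B 1 u = 1 := by
  simp [monomialVec]

theorem mem_affineCone_range_torusMap (hB : B.Nonempty) (v : B → ℂ) :
    v ∈ affineCone (Set.range (torusMap B hB)) ↔ ∃ (c : ℂ) (t : σ → ℂˣ), v = c • monomialVec B t := by
  constructor
  · intro hv
    by_cases h0 : v = 0
    · exact ⟨0, 1, by simp [h0]⟩
    · obtain ⟨t, ht⟩ := hv h0
      obtain ⟨c, hc⟩ := (Projectivization.mk_eq_mk_iff' ℂ _ _ _ _).1 ht.symm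
      exact ⟨c, t, hc.symm⟩
  · rintro ⟨c, t, rfl⟩ h
    exact ⟨t, (mk_smul_eq (monomialVec_ne_zero hB t) h).symm⟩

theorem mem_idealOf_toricVariety (hB : B.Nonempty) (F : MvPolynomial B ℂ) :
    F ∈ idealOf (toricVariety B hB) ↔
      ∀ (c : ℂ) (t : σ → ℂˣ), MvPolynomial.eval (c • monomialVec B t) F = 0 := by
  rw [toricVariety, idealOf_zariskiClosure, mem_idealOf]
  constructor
  · exact fun h c t => h _ ((mem_affineCone_range_torusMap hB _).2 ⟨c, t, rfl⟩)
  · intro h v hv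
    obtain ⟨c, t, rfl⟩ := (mem_affineCone_range_torusMap hB _).1 hv
    exact h c t

theorem prod_monomialVec_zpow (t : σ → ℂˣ) (c : B → ℤ)
    (hc : ∀ l, ∑ u : B, c u * (u : σ → ℤ) l = 0) : ∏ u : B, monomialVec B t u ^ c u = 1 := by
  have h : ∏ u : B, (∏ l, t l ^ (u : σ → ℤ) l) ^ c u = (1 : ℂˣ) := by
    simp only [← Finset.prod_zpow]
    rw [Finset.prod_comm]
    refine Finset.prod_eq_one fun l _ => ?_
    have h1 : ∀ s : Finset B, ∏ u ∈ s, (t l ^ (u : σ → ℤ) l) ^ c u =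
        t l ^ ∑ u ∈ s, c u * (u : σ → ℤ) l := by
      intro s
      classical
      induction s using Finset.induction_on with
      | empty => simp
      | insert a s ha ih =>
        rw [Finset.prod_insert ha, Finset.sum_insert ha, ih, zpow_add, ← zpow_mul, mul_comm (c a)]
    rw [h1, hc, zpow_zero]
  have := congrArg (Units.val : ℂˣ → ℂ) h
  simpa [monomialVec] using this

theorem prod_monomialVec_toNat (t : σ → ℂˣ) (c : B → ℤ)
    (hc : ∀ l, ∑ u : B, c u * (u : σ → ℤ) l = 0) :
    ∏ u : B, monomialVec B t u ^ (c u).toNat = ∏ u : B, monomialVec B t u ^ (-c u).toNat := by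
  have h := prod_monomialVec_zpow t c hc
  rw [← one_mul (∏ u : B, monomialVec B t u ^ (-c u).toNat), ← h, ← Finset.prod_mul_distrib]
  refine Finset.prod_congr rfl fun u _ => ?_
  rw [← zpow_natCast, ← zpow_natCast, ← zpow_add₀ (monomialVec_apply_ne_zero t u)]
  congr 1
  omega

theorem binomial_mem_idealOf (hB : B.Nonempty) (c : B → ℤ) (hc0 : ∑ u, c u = 0)
    (hc : ∀ l, ∑ u : B, c u * (u : σ → ℤ) l = 0) :
    binomial c ∈ idealOf (toricVariety B hB) := by
  rw [mem_idealOf_toricVariety]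
  intro x t
  rw [binomial, map_sub, eval_monomial_equivFun, eval_monomial_equivFun, sub_eq_zero]
  simp only [Pi.smul_apply, smul_eq_mul, mul_pow, Finset.prod_mul_distrib,
    prod_monomialVec_toNat t c hc, Finset.prod_pow_eq_pow_sum]
  congr 2
  have h1 : ∑ u, ((c u).toNat : ℤ) - ∑ u, ((-c u).toNat : ℤ) = 0 := by
    rw [← Finset.sum_sub_distrib, ← hc0]
    exact Finset.sum_congr rfl fun u _ => by omega
  exact_mod_cast sub_eq_zero.1 h1

/-- In logarithmic coordinates `w = v / p`, the gradient of the binomial of `c` at `p` is a nonzero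
multiple of `∑ c_u w_u`. So `w` is orthogonal to all integer affine relations among the points of
`B`, and is an affine function of `u`. -/
theorem exists_eq_of_mem_embTangent (hB : B.Nonempty) (t : σ → ℂˣ) (v : B → ℂ)
    (hv : v ∈ embTangent (toricVariety B hB) (torusMap B hB t)) :
    ∃ (x : ℂ) (μ : σ → ℂ), ∀ u : B,
      v u = monomialVec B t u * (x + ∑ l, μ l * ((u : σ → ℤ) l : ℂ)) := by
  set p := monomialVec B t with hp
  have hp0 : ∀ u, p u ≠ 0 := monomialVec_apply_ne_zero t
  rw [torusMap, mem_embTangent_mk] at hv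
  let w : B → ℂ := fun u => v u / p u
  have hvw : v = fun u => p u * w u := by
    ext u
    simp [w, mul_div_cancel₀ _ (hp0 u)]
  obtain ⟨μ, hμ⟩ := exists_eq_sum_of_forall_relation
    -- The extra index `none` carries the constant 1, so relations among these vectors are the
    -- affine ones, whose binomials are homogeneous.
    (fun (u : B) (l : Option σ) => l.elim 1 (u : σ → ℤ)) w fun c hc => by
      have h1 := hv _ (binomial_mem_idealOf hB c (by simpa using hc none)
        fun l => by simpa using hc (some l))
      have hsub : ∀ F G : MvPolynomial B ℂ, gradPair (F - G) p v = gradPair F p v - gradPair G p v :=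
        fun F G => by simp [gradPair, sub_mul]
      rw [← hp, binomial, hsub, hvw, gradPair_monomial, gradPair_monomial, hp,
        prod_monomialVec_toNat t c fun l => by simpa using hc (some l), ← mul_sub, mul_eq_zero,
        or_iff_right (Finset.prod_ne_zero_iff.2 fun u _ => pow_ne_zero _ (hp0 u)),
        ← Finset.sum_sub_distrib] at h1
      rw [← h1]
      refine Finset.sum_congr rfl fun u _ => ?_
      have : ((c u : ℤ) : ℂ) = (((c u).toNat : ℤ) : ℂ) - (((-c u).toNat : ℤ) : ℂ) := by
        rw [← Int.cast_sub]
        congr 1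
        omega
      rw [this]
      push_cast
      ring
  refine ⟨μ none, fun l => μ (some l), fun u => ?_⟩
  rw [hvw]
  simp [hμ u]

theorem monomialVec_exp (τ : σ → ℂ) (x : ℂ) (u : B) :
    monomialVec B (fun l => Units.mk0 (Complex.exp (x * τ l)) (Complex.exp_ne_zero _)) u =
      Complex.exp (x * ∑ l, τ l * ((u : σ → ℤ) l : ℂ)) := by
  simp only [monomialVec, Units.coe_prod, Units.val_zpow_eq_zpow_val, Units.val_mk0,
    ← Complex.exp_int_mul, ← Complex.exp_sum, Finset.mul_sum]
  congr 1
  exact Finset.sum_congr rfl fun l _ => by ring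

/-- Velocity at 0 of the curve `(1 + y) • p`, which stays in the cone. -/
theorem monomialVec_mem_embTangent (hB : B.Nonempty) (t : σ → ℂˣ) :
    monomialVec B t ∈ embTangent (toricVariety B hB) (torusMap B hB t) := by
  rw [torusMap, mem_embTangent_mk]
  intro F hF
  rw [mem_idealOf_toricVariety] at hF
  have h1 := hasDerivAt_eval_comp F (fun y => (1 + y) • monomialVec B t) (monomialVec B t) 0
    fun i => by
      simpa using ((hasDerivAt_id (0 : ℂ)).const_add 1).mul_const (monomialVec B t i)
  simp only [hF, add_zero, one_smul] at h1
  exact h1.unique (hasDerivAt_const _ _)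

/-- Velocity at 0 of the orbit of `t` under the one-parameter group `exp(yτ)`. -/
theorem torus_direction_mem_embTangent (hB : B.Nonempty) (t : σ → ℂˣ) (τ : σ → ℂ) :
    (fun u : B => monomialVec B t u * ∑ l, τ l * ((u : σ → ℤ) l : ℂ)) ∈
      embTangent (toricVariety B hB) (torusMap B hB t) := by
  rw [torusMap, mem_embTangent_mk]
  intro F hF
  rw [mem_idealOf_toricVariety] at hF
  let s : ℂ → σ → ℂˣ := fun x l => Units.mk0 (Complex.exp (x * τ l)) (Complex.exp_ne_zero _)
  have h1 := hasDerivAt_eval_comp F (fun y => monomialVec B (t * s y)) _ 0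
    fun u => by
      simp only [monomialVec_mul, s, monomialVec_exp]
      exact (((hasDerivAt_id (0 : ℂ)).mul_const _).cexp).const_mul (monomialVec B t u)
  have h2 : ∀ y, MvPolynomial.eval (monomialVec B (t * s y)) F = 0 := fun y => by
    simpa using hF 1 (t * s y)
  have h3 : s 0 = 1 := by
    ext l
    simp [s]
  simp only [h2, h3, mul_one] at h1
  have h4 := h1.unique (hasDerivAt_const _ _)
  simpa [gradPair] using h4

/-- A hyperplane is tangent at a point of the torus iff its equation and all logarithmic
derivatives of it vanish there. -/
theorem forall_embTangent_iff (hB : B.Nonempty) (t : σ → ℂˣ) (a : B → ℂ) :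
    (∀ v ∈ embTangent (toricVariety B hB) (torusMap B hB t), ∑ u, a u * v u = 0) ↔
      ∑ u, a u * monomialVec B t u = 0 ∧
        ∀ l, ∑ u : B, a u * monomialVec B t u * ((u : σ → ℤ) l : ℂ) = 0 := by
  classical
  constructor
  · intro h
    refine ⟨h _ (monomialVec_mem_embTangent hB t), fun l => ?_⟩
    have h1 := h _ (torus_direction_mem_embTangent hB t (Pi.single l 1))
    simpa [Pi.single_apply, ite_mul, mul_assoc] using h1
  · rintro ⟨h0, h1⟩ v hv
    obtain ⟨x, μ, h⟩ := exists_eq_of_mem_embTangent hB t v hv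
    have : ∑ u, a u * v u = x * ∑ u, a u * monomialVec B t u +
        ∑ l, μ l * ∑ u : B, a u * monomialVec B t u * ((u : σ → ℤ) l : ℂ) := by
      simp only [Finset.mul_sum]
      rw [Finset.sum_comm, ← Finset.sum_add_distrib]
      refine Finset.sum_congr rfl fun u _ => ?_
      rw [h, mul_add, mul_add, Finset.mul_sum, Finset.mul_sum]
      congr 1
      · ring
      · exact Finset.sum_congr rfl fun l _ => by ring
    rw [this, h0]
    simp only [h1, mul_zero, Finset.sum_const_zero, add_zero]

end ToricTangent

/-! ### Coordinates of a Cayley sum -/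

section Cayley

variable {d r : ℕ}

theorem cayleyPoint_inj {i j : Fin (r + 1)} {u v : Fin d → ℤ}
    (h : cayleyPoint i u = cayleyPoint j v) : i = j ∧ u = v := by
  constructor
  · have h1 : ∀ l : Fin r, i = l.succ ↔ j = l.succ := fun l => by
      have := congrFun h (Sum.inr l)
      simp only [cayleyPoint, Sum.elim_inr] at this
      split_ifs at this <;> simp_all
    induction i using Fin.cases with
    | zero =>
      induction j using Fin.cases with
      | zero => rfl
      | succ l => exact (h1 l).2 rfl
    | succ l => exact ((h1 l).1 rfl).symm
  · ext l
    exact congrFun h (Sum.inl l)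

variable (A : Fin (r + 1) → Finset (Fin d → ℤ))

/-- The point `(u, e_i)` of the Cayley sum. -/
def cayleyMk (x : Σ i, A i) : cayleySum A :=
  ⟨cayleyPoint x.1 (x.2 : Fin d → ℤ), cayleyPoint_mem A x.1 x.2⟩

theorem cayleyMk_bijective : Function.Bijective (cayleyMk A) := by
  constructor
  · rintro ⟨i, u, hu⟩ ⟨j, v, hv⟩ h
    obtain ⟨rfl, rfl⟩ := cayleyPoint_inj (congrArg Subtype.val h)
    rfl
  · rintro ⟨b, hb⟩
    obtain ⟨i, -, hi⟩ := Finset.mem_biUnion.1 hb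
    obtain ⟨u, hu, rfl⟩ := Finset.mem_image.1 hi
    exact ⟨⟨i, u, hu⟩, rfl⟩

/-- The Cayley sum is the disjoint union of the `A_i`. -/
def cayleyEquiv : (Σ i, A i) ≃ cayleySum A := Equiv.ofBijective _ (cayleyMk_bijective A)

theorem sum_cayleySum {M : Type*} [AddCommMonoid M] (f : cayleySum A → M) :
    ∑ b, f b = ∑ i, ∑ u : A i, f (cayleyMk A ⟨i, u⟩) := by
  rw [← Equiv.sum_comp (cayleyEquiv A) f, Fintype.sum_sigma]
  rfl

/-- Multiplying the block of coordinates belonging to `A_i` by `s_i`. -/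
def blockScale (s : Fin (r + 1) → ℂ) (a : cayleySum A → ℂ) : cayleySum A → ℂ :=
  fun b => s ((cayleyEquiv A).symm b).1 * a b

theorem cayleyEquiv_symm_mk (x : Σ i, A i) : (cayleyEquiv A).symm (cayleyMk A x) = x :=
  (cayleyEquiv A).symm_apply_apply x

theorem cayleyMk_symm (b : cayleySum A) : cayleyMk A ((cayleyEquiv A).symm b) = b :=
  (cayleyEquiv A).apply_symm_apply b

theorem blockScale_mk (s : Fin (r + 1) → ℂ) (a : cayleySum A → ℂ) (i : Fin (r + 1)) (u : A i) :
    blockScale A s a (cayleyMk A ⟨i, u⟩) = s i * a (cayleyMk A ⟨i, u⟩) := by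
  rw [blockScale, cayleyEquiv_symm_mk]

theorem moments_apply (a : cayleySum A → ℂ) (i : Fin (r + 1)) (l : Fin d) :
    moments A a i l = ∑ u : A i, a (cayleyMk A ⟨i, u⟩) * ((u : Fin d → ℤ) l : ℂ) := rfl

/-- The moments as a linear map. -/
def momentsLin : (cayleySum A → ℂ) →ₗ[ℂ] (Fin (r + 1) → Fin d → ℂ) where
  toFun := moments A
  map_add' a b := by
    ext i l
    simp only [moments_apply, Pi.add_apply, add_mul, Finset.sum_add_distrib]
  map_smul' c a := by
    ext i l
    simp only [moments_apply, Pi.smul_apply, smul_eq_mul, Finset.mul_sum, mul_assoc,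
      RingHom.id_apply]

theorem momentsLin_apply (a : cayleySum A → ℂ) : momentsLin A a = moments A a := rfl

theorem moments_blockScale (s : Fin (r + 1) → ℂ) (a : cayleySum A → ℂ) :
    moments A (blockScale A s a) = fun i => s i • moments A a i := by
  ext i l
  simp only [moments_apply, blockScale_mk, Pi.smul_apply, smul_eq_mul, Finset.mul_sum, mul_assoc]

/-- The linear space of equations of hyperplanes tangent at the unit of the torus. -/
def tangentSystem : Submodule ℂ (cayleySum A → ℂ) where
  carrier := {a | (∀ i, ∑ u : A i, a (cayleyMk A ⟨i, u⟩) = 0) ∧ ∑ i, moments A a i = 0}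
  zero_mem' := ⟨by simp, by
    have : moments A 0 = 0 := map_zero (momentsLin A)
    simp [this]⟩
  add_mem' := by
    rintro a b ⟨h, h'⟩ ⟨k, k'⟩
    refine ⟨fun i => ?_, ?_⟩
    · simp only [Pi.add_apply, Finset.sum_add_distrib, h, k, add_zero]
    · have : moments A (a + b) = moments A a + moments A b := map_add (momentsLin A) a b
      simp only [this, Pi.add_apply, Finset.sum_add_distrib, h', k', add_zero]
  smul_mem' := by
    rintro c a ⟨h, h'⟩
    refine ⟨fun i => ?_, ?_⟩
    · simp only [Pi.smul_apply, ← Finset.smul_sum, h, smul_zero]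
    · have : moments A (c • a) = c • moments A a := map_smul (momentsLin A) c a
      simp only [this, Pi.smul_apply, ← Finset.smul_sum, h', smul_zero]

theorem mem_tangentSystem {a : cayleySum A → ℂ} :
    a ∈ tangentSystem A ↔
      (∀ i, ∑ u : A i, a (cayleyMk A ⟨i, u⟩) = 0) ∧ ∑ i, moments A a i = 0 := Iff.rfl

theorem blockScale_mem_tangentSystem {a : cayleySum A → ℂ} (ha : a ∈ tangentSystem A)
    (s : Fin (r + 1) → ℂ) :
    blockScale A s a ∈ tangentSystem A ↔ ∑ i, s i • moments A a i = 0 := by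
  rw [mem_tangentSystem, moments_blockScale, and_iff_right]
  intro i
  simp only [blockScale_mk, ← Finset.mul_sum, ha.1, mul_zero]

/-- The last `r` coordinates of a Cayley point are block indicators, so they yield the block sums
for `i ≥ 1`; block 0 then follows from the total sum. -/
theorem mem_tangentSystem_iff (a : cayleySum A → ℂ) :
    a ∈ tangentSystem A ↔ ∑ b, a b = 0 ∧
      ∀ l, ∑ b : cayleySum A, a b * ((b : Fin d ⊕ Fin r → ℤ) l : ℂ) = 0 := by
  have hl : ∀ l : Fin d, ∑ b : cayleySum A, a b * ((b : Fin d ⊕ Fin r → ℤ) (Sum.inl l) : ℂ) =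
      (∑ i, moments A a i) l := fun l => by
    rw [sum_cayleySum, Finset.sum_apply]
    rfl
  have hr : ∀ k : Fin r, ∑ b : cayleySum A, a b * ((b : Fin d ⊕ Fin r → ℤ) (Sum.inr k) : ℂ) =
      ∑ u : A k.succ, a (cayleyMk A ⟨k.succ, u⟩) := fun k => by
    rw [sum_cayleySum, Finset.sum_eq_single k.succ]
    · simp [cayleyMk, cayleyPoint]
    · intro i _ hi
      simp [cayleyMk, cayleyPoint, hi]
    · simp
  rw [mem_tangentSystem, sum_cayleySum, Sum.forall]
  simp only [hl, hr]
  constructor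
  · rintro ⟨h, h'⟩
    exact ⟨Finset.sum_eq_zero fun i _ => h i, fun l => congrFun h' l, fun k => h _⟩
  · rintro ⟨h0, h1, h2⟩
    refine ⟨fun i => ?_, funext h1⟩
    induction i using Fin.cases with
    | zero =>
      rw [Fin.sum_univ_succ] at h0
      simpa only [h2, Finset.sum_const_zero, add_zero] using h0
    | succ k => exact h2 k

variable {A} (hne : (cayleySum A).Nonempty)

theorem forall_embTangent_cayley_iff (t : Fin d ⊕ Fin r → ℂˣ) (a : cayleySum A → ℂ) :
    (∀ v ∈ embTangent (toricVariety (cayleySum A) hne) (torusMap (cayleySum A) hne t),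
      ∑ u, a u * v u = 0) ↔
      (fun b => a b * monomialVec (cayleySum A) t b) ∈ tangentSystem A := by
  rw [forall_embTangent_iff, mem_tangentSystem_iff]

theorem mk_mem_tangentHyperplanesAtOne (a : cayleySum A → ℂ) (ha : a ≠ 0) :
    Projectivization.mk ℂ a ha ∈ tangentHyperplanesAtOne (cayleySum A) hne ↔
      a ∈ tangentSystem A := by
  have := forall_embTangent_cayley_iff hne 1 a
  simp only [monomialVec_one, mul_one] at this
  rw [← this]
  exact isTangentAt_mk _ _ _ _

theorem affineCone_tangentHyperplanesAtOne :
    affineCone (tangentHyperplanesAtOne (cayleySum A) hne) = tangentSystem A := by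
  ext a
  by_cases ha : a = 0
  · subst ha
    exact iff_of_true (zero_mem_affineCone _) (zero_mem _)
  · rw [SetLike.mem_coe, ← mk_mem_tangentHyperplanesAtOne hne a ha]
    exact ⟨fun h => h ha, fun h _ => h⟩

/-! ### Moments and the kernel `K` -/

theorem sum_smul_mem_diffSpan (B : Finset (Fin d → ℤ)) (q : B → ℚ) (hq : ∑ u, q u = 0) :
    (fun l => ∑ u : B, q u * ((u : Fin d → ℤ) l : ℚ)) ∈ diffSpan B := by
  rcases B.eq_empty_or_nonempty with rfl | ⟨v, hv⟩
  · convert zero_mem (diffSpan (∅ : Finset (Fin d → ℤ)))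
    simp
  · have : (fun l => ∑ u : B, q u * ((u : Fin d → ℤ) l : ℚ)) =
        ∑ u : B, q u • fun l => (((u : Fin d → ℤ) l - v l : ℤ) : ℚ) := by
      ext l
      rw [Finset.sum_apply]
      simp only [Pi.smul_apply, smul_eq_mul, Int.cast_sub, mul_sub, Finset.sum_sub_distrib,
        ← Finset.sum_mul, hq, zero_mul, sub_zero]
    rw [this]
    exact sum_mem fun u _ => Submodule.smul_mem _ _ (Submodule.subset_span ⟨u, u.2, v, hv, rfl⟩)

theorem exists_of_mem_diffSpan (B : Finset (Fin d → ℤ)) {w : Fin d → ℚ} (hw : w ∈ diffSpan B) :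
    ∃ q : B → ℚ, ∑ u, q u = 0 ∧ ∀ l, w l = ∑ u : B, q u * ((u : Fin d → ℤ) l : ℚ) := by
  induction hw using Submodule.span_induction with
  | mem x hx =>
    obtain ⟨u, hu, v, hv, rfl⟩ := hx
    refine ⟨Pi.single ⟨u, hu⟩ 1 - Pi.single ⟨v, hv⟩ 1, by simp, fun l => ?_⟩
    simp [sub_mul, Pi.single_apply, ite_mul]
  | zero => exact ⟨0, by simp, by simp⟩
  | add x y _ _ hx hy =>
    obtain ⟨p, hp, hp'⟩ := hx
    obtain ⟨q, hq, hq'⟩ := hy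
    refine ⟨p + q, ?_, fun l => ?_⟩
    · simp only [Pi.add_apply, Finset.sum_add_distrib, hp, hq, add_zero]
    · simp only [Pi.add_apply, add_mul, Finset.sum_add_distrib, hp', hq']
  | smul c x _ hx =>
    obtain ⟨p, hp, hp'⟩ := hx
    refine ⟨c • p, ?_, fun l => ?_⟩
    · simp only [Pi.smul_apply, ← Finset.smul_sum, hp, smul_zero]
    · simp only [Pi.smul_apply, smul_eq_mul, mul_assoc, ← Finset.mul_sum, hp']

/-- The kernel `K_ℂ`. -/
abbrev momentKernel (A : Fin (r + 1) → Finset (Fin d → ℤ)) :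
    Submodule ℂ (Fin (r + 1) → Fin d → ℂ) :=
  complexifyTuple (sumKernel fun i => diffSpan (A i))

/-- The space `L` is defined by integer equations, so it is spanned by rational solutions. The
moments of a rational solution lie in `K`, because weights of sum zero turn points of `A_i` into
elements of `V_i`. -/
theorem moments_mem_momentKernel {a : cayleySum A → ℂ} (ha : a ∈ tangentSystem A) :
    moments A a ∈ momentKernel A := by
  have h0 := (mem_tangentSystem_iff A a).1 ha
  have h1 := mem_span_rational_solutions
    (fun (b : cayleySum A) (l : Fin (r + 1) ⊕ Fin d) => l.elim
      (fun j => if ((cayleyEquiv A).symm b).1 = j then 1 else 0)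
      (fun k => (b : Fin d ⊕ Fin r → ℤ) (Sum.inl k))) a (by
      rintro (j | k)
      · rw [sum_cayleySum, Finset.sum_eq_single j]
        · simpa [cayleyEquiv_symm_mk] using ha.1 j
        · intro i _ hi
          simp [cayleyEquiv_symm_mk, hi]
        · simp
      · exact h0.2 _)
  have h2 := Submodule.mem_map_of_mem (f := momentsLin A) h1
  rw [Submodule.map_span] at h2
  refine Submodule.span_mono ?_ h2
  rintro _ ⟨_, ⟨q, hq, rfl⟩, rfl⟩
  refine ⟨fun i l => ∑ u : A i, q (cayleyMk A ⟨i, u⟩) * ((u : Fin d → ℤ) l : ℚ),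
    ⟨fun i => sum_smul_mem_diffSpan (A i) (fun u => q (cayleyMk A ⟨i, u⟩)) ?_, ?_⟩, ?_⟩
  · have := hq (Sum.inl i)
    rw [sum_cayleySum, Finset.sum_eq_single i] at this
    · simpa [cayleyEquiv_symm_mk] using this
    · intro j _ hj
      simp [cayleyEquiv_symm_mk, hj]
    · simp
  · ext l
    have := hq (Sum.inr l)
    rw [sum_cayleySum] at this
    rw [Finset.sum_apply]
    exact this
  · ext i l
    rw [momentsLin_apply, moments_apply]
    push_cast
    rfl

theorem apply_mem_complexify {V : Fin (r + 1) → Submodule ℚ (Fin d → ℚ)}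
    {m : Fin (r + 1) → Fin d → ℂ} (hm : m ∈ complexifyTuple (sumKernel V)) (i : Fin (r + 1)) :
    m i ∈ complexify (V i) := by
  have h2 := Submodule.mem_map_of_mem (f := LinearMap.proj (R := ℂ) (φ := fun _ => Fin d → ℂ) i) hm
  rw [complexifyTuple, Submodule.map_span] at h2
  refine Submodule.span_mono ?_ h2
  rintro _ ⟨_, ⟨q, hq, rfl⟩, rfl⟩
  exact ⟨q i, hq.1 i, rfl⟩

theorem sum_eq_zero_of_mem_complexifyTuple {V : Fin (r + 1) → Submodule ℚ (Fin d → ℚ)}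
    {m : Fin (r + 1) → Fin d → ℂ} (hm : m ∈ complexifyTuple (sumKernel V)) : ∑ i, m i = 0 := by
  induction hm using Submodule.span_induction with
  | mem x hx =>
    obtain ⟨q, hq, rfl⟩ := hx
    ext l
    have := congrArg (Rat.cast (K := ℂ)) (congrFun hq.2 l)
    simpa using this
  | zero => simp
  | add x y _ _ hx hy => simp [Finset.sum_add_distrib, hx, hy]
  | smul c x _ hx => simp [← Finset.smul_sum, hx]

/-- It suffices to reach rational tuples of `K`. There each `m_i` is a combination of points of
`A_i` with weights of sum zero, and these weights are the coefficients. -/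
theorem exists_moments_eq {m : Fin (r + 1) → Fin d → ℂ} (hm : m ∈ momentKernel A) :
    ∃ a ∈ tangentSystem A, moments A a = m := by
  suffices h : momentKernel A ≤ (tangentSystem A).map (momentsLin A) from h hm
  refine Submodule.span_le.2 ?_
  rintro _ ⟨m, hm, rfl⟩
  choose q hq0 hq using fun i => exists_of_mem_diffSpan (A i) (hm.1 i)
  let a : cayleySum A → ℂ := fun b => q ((cayleyEquiv A).symm b).1 ((cayleyEquiv A).symm b).2
  have ha : ∀ i u, a (cayleyMk A ⟨i, u⟩) = q i u := fun i u =>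
    congrArg (fun x : Σ i, A i => (q x.1 x.2 : ℂ)) (cayleyEquiv_symm_mk A ⟨i, u⟩)
  have hm' : moments A a = fun i l => (m i l : ℂ) := by
    ext i l
    rw [moments_apply, hq]
    simp only [ha]
    push_cast
    rfl
  refine ⟨a, ⟨fun i => ?_, ?_⟩, hm'⟩
  · simp only [ha]
    exact_mod_cast hq0 i
  · rw [hm']
    exact sum_eq_zero_of_mem_complexifyTuple (V := fun i => diffSpan (A i))
      (Submodule.subset_span ⟨m, hm, rfl⟩)

/-! ### Generality of the moments -/

/-- The polynomial `F ∘ moments`. -/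
def momentsPullback (F : MvPolynomial (Fin (r + 1) × Fin d) ℂ) : MvPolynomial (cayleySum A) ℂ :=
  linearPullback (((LinearEquiv.curry ℂ ℂ (Fin (r + 1)) (Fin d)).symm.toLinearMap).comp
    (momentsLin A)) F

theorem eval_momentsPullback (F : MvPolynomial (Fin (r + 1) × Fin d) ℂ) (a : cayleySum A → ℂ) :
    MvPolynomial.eval a (momentsPullback F) =
      MvPolynomial.eval (fun q => moments A a q.1 q.2) F := by
  rw [momentsPullback, eval_linearPullback]
  rfl

theorem notMem_tupleZeroLocus {I : Ideal (MvPolynomial (Fin (r + 1) × Fin d) ℂ)}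
    {m : Fin (r + 1) → Fin d → ℂ} :
    m ∉ tupleZeroLocus I ↔ ∃ F ∈ I, MvPolynomial.eval (fun q => m q.1 q.2) F ≠ 0 := by
  rw [tupleZeroLocus, Set.mem_ofPred_eq, MvPolynomial.mem_zeroLocus_iff]
  push Not
  rfl

theorem exists_ideal_moments (I : Ideal (MvPolynomial (Fin (r + 1) × Fin d) ℂ))
    (hI : ¬ (momentKernel A : Set (Fin (r + 1) → Fin d → ℂ)) ⊆ tupleZeroLocus I) :
    ∃ J : Ideal (MvPolynomial (cayleySum A) ℂ),
      (¬ affineCone (tangentHyperplanesAtOne (cayleySum A) hne) ⊆ MvPolynomial.zeroLocus ℂ J) ∧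
      ∀ a ∈ affineCone (tangentHyperplanesAtOne (cayleySum A) hne),
        a ∉ MvPolynomial.zeroLocus ℂ J → moments A a ∉ tupleZeroLocus I := by
  obtain ⟨m, hm, hmI⟩ := Set.not_subset.1 hI
  obtain ⟨F, hF, hFm⟩ := notMem_tupleZeroLocus.1 hmI
  obtain ⟨a, ha, rfl⟩ := exists_moments_eq hm
  have key : ∀ b, b ∈ MvPolynomial.zeroLocus ℂ (Ideal.span {momentsPullback (A := A) F}) ↔
      MvPolynomial.eval (fun q => moments A b q.1 q.2) F = 0 := fun b => by
    rw [MvPolynomial.zeroLocus_span, ← eval_momentsPullback]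
    simp [MvPolynomial.aeval_eq_eval]
  refine ⟨Ideal.span {momentsPullback F}, fun h => ?_, fun b _ hb => ?_⟩
  · rw [affineCone_tangentHyperplanesAtOne] at h
    exact hFm ((key a).1 (h ha))
  · rw [key] at hb
    exact notMem_tupleZeroLocus.2 ⟨F, hF, hb⟩

theorem holdsGenerally_moments (I : Ideal (MvPolynomial (Fin (r + 1) × Fin d) ℂ))
    (hI : ¬ (momentKernel A : Set (Fin (r + 1) → Fin d → ℂ)) ⊆ tupleZeroLocus I) :
    HoldsGenerally (tangentHyperplanesAtOne (cayleySum A) hne)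
      (fun H => ∃ (a : cayleySum A → ℂ) (ha : a ≠ 0),
        Projectivization.mk ℂ a ha = H ∧ moments A a ∉ tupleZeroLocus I) := by
  obtain ⟨m, hm, hmI⟩ := Set.not_subset.1 hI
  obtain ⟨F, hF, hFm⟩ := notMem_tupleZeroLocus.1 hmI
  obtain ⟨a, ha, rfl⟩ := exists_moments_eq hm
  rw [← eval_momentsPullback] at hFm
  refine ⟨lineZeroLocus (momentsPullback F), isAlgebraicSet_lineZeroLocus _, ?_, ?_⟩
  · rintro ⟨H, hH⟩ hsub
    -- The witness `a` may be zero, for instance if `K = 0`. It then gives no point of projective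
    -- space, but it lies on the line of any `H`.
    by_cases ha0 : a = 0
    · apply hFm
      simpa [ha0] using hsub hH 0
    · have h1 := hsub ((mk_mem_tangentHyperplanesAtOne hne a ha0).2 ha)
      apply hFm
      simpa using (mk_mem_lineZeroLocus ha0).1 h1 1
  · intro H _ hHS
    have h1 : ∃ c : ℂ, MvPolynomial.eval (c • H.rep) (momentsPullback (A := A) F) ≠ 0 := by
      by_contra! h
      exact hHS h
    -- `F` need not be homogeneous, so only a suitable multiple of the equation avoids its zero set.
    obtain ⟨c, hc, hc'⟩ := exists_ne_zero_eval_smul h1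
    have h0 : c • H.rep ≠ 0 := smul_ne_zero hc H.rep_nonzero
    refine ⟨c • H.rep, h0, ?_, ?_⟩
    · rw [mk_smul_eq H.rep_nonzero h0, Projectivization.mk_rep]
    · rw [eval_momentsPullback] at hc'
      exact notMem_tupleZeroLocus.2 ⟨F, hF, hc'⟩

end Cayley

/-! ### Generic rank of tuples -/

theorem exists_finset_linearIndependent {k V : Type} [Field k] [AddCommGroup V] [Module k V]
    {n : ℕ} (m : Fin n → V) : ∃ J : Finset (Fin n),
      J.card = Module.finrank k (Submodule.span k (Set.range m)) ∧
        LinearIndependent k fun j : J => m j := by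
  classical
  obtain ⟨κ, a, hinj, hspan, hli⟩ := exists_linearIndependent' k m
  have : Finite κ := Finite.of_injective a hinj
  have := Fintype.ofFinite κ
  refine ⟨Finset.univ.image a, ?_, ?_⟩
  · rw [Finset.card_image_of_injective _ hinj, ← hspan, finrank_span_eq_card hli, Finset.card_univ]
  · have h : ∀ j : Finset.univ.image a, ∃ x, a x = j := fun j => by
      obtain ⟨x, -, hx⟩ := Finset.mem_image.1 j.2
      exact ⟨x, hx⟩
    choose f hf using h
    have := hli.comp f fun i j hij => by
      apply Subtype.ext
      rw [← hf, ← hf, hij]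
    convert! this using 1
    ext j
    simp [hf]

section Rank

variable {d : ℕ} {κ : Type} [Fintype κ] [DecidableEq κ]

theorem exists_right_inverse_of_linearIndependent {k : Type} [Field k] (M : Matrix κ (Fin d) k)
    (hM : LinearIndependent k fun j => M j) : ∃ N : Matrix (Fin d) κ k, M * N = 1 := by
  have h1 : Function.Injective M.vecMulLinear := Matrix.vecMul_injective_iff.2 hM
  obtain ⟨g, hg⟩ := LinearMap.exists_leftInverse_of_injective _ (LinearMap.ker_eq_bot.2 h1)
  refine ⟨Matrix.of fun l j => g (Pi.single l 1) j, ?_⟩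
  ext i j
  have h2 := congrFun (LinearMap.congr_fun hg (Pi.single i 1)) j
  rw [LinearMap.comp_apply, linearMap_apply_eq_sum g] at h2
  simp only [Matrix.vecMulLinear_apply, Matrix.single_one_vecMul, LinearMap.id_apply] at h2
  rw [Matrix.mul_apply, Matrix.one_apply]
  simpa [Finset.sum_apply, Pi.single_apply, eq_comm] using h2

theorem linearIndependent_of_mul {k : Type} [Field k] (M : Matrix κ (Fin d) k)
    (N : Matrix (Fin d) κ k) (h : (M * N).det ≠ 0) : LinearIndependent k fun j => M j := by
  have h1 := Matrix.linearIndependent_rows_of_det_ne_zero h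
  exact LinearIndependent.of_comp N.vecMulLinear h1

/-- Upwards, independence over `ℚ` gives a rational right inverse, which remains one over `ℂ`. -/
theorem linearIndependent_ratCast (M : κ → Fin d → ℚ) :
    LinearIndependent ℂ (fun j l => (M j l : ℂ)) ↔ LinearIndependent ℚ M := by
  constructor
  · intro h
    let c : (Fin d → ℚ) →ₗ[ℚ] (Fin d → ℂ) :=
      { toFun := fun v l => (v l : ℂ)
        map_add' := fun v w => by ext l; simp
        map_smul' := fun x v => by ext l; simp [Rat.smul_def] }
    have h1 : LinearIndependent ℚ (fun j l => (M j l : ℂ)) := h.restrict_scalars fun x y hxy => by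
      simpa [Rat.smul_def] using hxy
    exact LinearIndependent.of_comp c h1
  · intro h
    obtain ⟨N, hN⟩ := exists_right_inverse_of_linearIndependent (Matrix.of M) h
    have h1 := congrArg (fun X => X.map (Rat.castHom ℂ)) hN
    simp only [Matrix.map_mul] at h1
    refine linearIndependent_of_mul ((Matrix.of M).map (Rat.castHom ℂ)) (N.map (Rat.castHom ℂ)) ?_
    rw [h1]
    simp

/-- A polynomial whose nonvanishing forces the rows with index in `J` to be independent. -/
theorem exists_minor {r : ℕ} (J : Finset (Fin (r + 1))) (m : Fin (r + 1) → Fin d → ℂ)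
    (hm : LinearIndependent ℂ fun j : J => m j) :
    ∃ F : MvPolynomial (Fin (r + 1) × Fin d) ℂ,
      MvPolynomial.eval (fun q => m q.1 q.2) F ≠ 0 ∧
      ∀ m' : Fin (r + 1) → Fin d → ℂ, MvPolynomial.eval (fun q => m' q.1 q.2) F ≠ 0 →
        LinearIndependent ℂ fun j : J => m' j := by
  obtain ⟨N, hN⟩ := exists_right_inverse_of_linearIndependent (Matrix.of fun j : J => m j) hm
  -- Multiplying by a right inverse `N` of the rows of `m` in `J` avoids choosing columns: the
  -- determinant is 1 at `m`.
  let F : MvPolynomial (Fin (r + 1) × Fin d) ℂ := Matrix.det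
    (Matrix.of fun (j k : J) => ∑ l, MvPolynomial.X ((j : Fin (r + 1)), l) * MvPolynomial.C (N l k))
  have hF : ∀ m' : Fin (r + 1) → Fin d → ℂ, MvPolynomial.eval (fun q => m' q.1 q.2) F =
      ((Matrix.of fun j : J => m' j) * N).det := fun m' => by
    rw [RingHom.map_det]
    congr 1
    ext j k
    simp [Matrix.mul_apply]
  refine ⟨F, by simp [hF, hN], fun m' h => ?_⟩
  rw [hF] at h
  exact linearIndependent_of_mul _ _ h

end Rank

section Alpha

variable {d r : ℕ} (V : Fin (r + 1) → Submodule ℚ (Fin d → ℚ))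

theorem bddAbove_alphaInv : BddAbove {s | ∃ m ∈ sumKernel V,
    s = Module.finrank ℚ (Submodule.span ℚ (Set.range m))} := by
  refine ⟨r + 1, ?_⟩
  rintro _ ⟨m, -, rfl⟩
  simpa [Set.finrank] using finrank_range_le_card (R := ℚ) m

theorem exists_finrank_eq_alphaInv :
    ∃ m ∈ sumKernel V, alphaInv V = Module.finrank ℚ (Submodule.span ℚ (Set.range m)) := by
  have h : {s | ∃ m ∈ sumKernel V,
      s = Module.finrank ℚ (Submodule.span ℚ (Set.range m))}.Nonempty := ⟨_, 0, zero_mem _, rfl⟩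
  exact Nat.sSup_mem h (bddAbove_alphaInv V)

variable {V}

/-- `m` is a complex combination of rational tuples `q k`. A minor that is nonzero at `m` is a
nonzero polynomial in the coefficients, hence nonzero at some rational coefficients, and these give
a tuple of `K` of at least the same rank. -/
theorem card_le_alphaInv {m : Fin (r + 1) → Fin d → ℂ} (hm : m ∈ complexifyTuple (sumKernel V))
    (J : Finset (Fin (r + 1))) (hJ : LinearIndependent ℂ fun j : J => m j) :
    J.card ≤ alphaInv V := by
  obtain ⟨F, hFm, hF⟩ := exists_minor J m hJ
  obtain ⟨n, c, x, hx⟩ := Submodule.mem_span_set'.1 hm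
  choose q hq hqx using fun k => (x k).2
  have hqx' : ∀ k i l, (x k : Fin (r + 1) → Fin d → ℂ) i l = (q k i l : ℂ) :=
    fun k i l => (congrFun (congrFun (hqx k) i) l).symm
  let G : MvPolynomial (Fin n) ℂ := MvPolynomial.aeval
    (fun p : Fin (r + 1) × Fin d => ∑ k, MvPolynomial.X k * MvPolynomial.C (q k p.1 p.2 : ℂ)) F
  have hG : ∀ y, MvPolynomial.eval y G =
      MvPolynomial.eval (fun p => ∑ k, y k * (q k p.1 p.2 : ℂ)) F := fun y => by
    rw [eval_aeval]
    simp
  have hG0 : G ≠ 0 := by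
    intro h0
    apply hFm
    have := hG c
    rw [h0, map_zero] at this
    rw [this]
    congr 2
    ext p
    simp [← hx, Finset.sum_apply, hqx']
  obtain ⟨y, hy⟩ : ∃ y : Fin n → ℚ, MvPolynomial.eval (fun k => (y k : ℂ)) G ≠ 0 := by
    by_contra! h
    refine hG0 (MvPolynomial.funext_set (fun _ => Set.range ((↑) : ℚ → ℂ))
      (fun _ => Set.infinite_range_of_injective Rat.cast_injective) fun z hz => ?_)
    choose y hy using fun k => hz k (Set.mem_univ k)
    have : z = fun k => (y k : ℂ) := funext fun k => (hy k).symm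
    rw [this, h, map_zero]
  rw [hG] at hy
  let m' : Fin (r + 1) → Fin d → ℚ := ∑ k, y k • q k
  have hm' : m' ∈ sumKernel V := sum_mem fun k _ => Submodule.smul_mem _ _ (hq k)
  have h1 := hF (fun i l => (m' i l : ℂ)) (by
    convert! hy using 3
    ext p
    simp [m', Finset.sum_apply])
  have h2 := (linearIndependent_ratCast fun j : J => m' j).1 h1
  have h3 : J.card ≤ Module.finrank ℚ (Submodule.span ℚ (Set.range m')) := by
    rw [← Fintype.card_coe, ← finrank_span_eq_card h2]
    exact Submodule.finrank_mono (Submodule.span_mono (by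
      rintro _ ⟨j, rfl⟩
      exact ⟨j, rfl⟩))
  exact h3.trans (le_csSup (bddAbove_alphaInv V) ⟨m', hm', rfl⟩)

theorem finrank_span_le_alphaInv {m : Fin (r + 1) → Fin d → ℂ}
    (hm : m ∈ complexifyTuple (sumKernel V)) :
    Module.finrank ℂ (Submodule.span ℂ (Set.range m)) ≤ alphaInv V := by
  obtain ⟨J, hJ, hli⟩ := exists_finset_linearIndependent (k := ℂ) m
  rw [← hJ]
  exact card_le_alphaInv hm J hli

/-- Tuples with a maximal number of independent entries at fixed places `J`. -/
theorem span_eq_of_card_eq_alphaInv {m : Fin (r + 1) → Fin d → ℂ}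
    (hm : m ∈ complexifyTuple (sumKernel V)) (J : Finset (Fin (r + 1)))
    (hJ : J.card = alphaInv V) (hli : LinearIndependent ℂ fun j : J => m j) :
    Submodule.span ℂ (Set.range fun j : J => m j) = Submodule.span ℂ (Set.range m) := by
  apply Submodule.eq_of_le_of_finrank_le
  · refine Submodule.span_mono ?_
    rintro _ ⟨j, rfl⟩
    exact ⟨j, rfl⟩
  · rw [finrank_span_eq_card hli, Fintype.card_coe, hJ]
    exact finrank_span_le_alphaInv hm

variable (V) in
theorem exists_generic_minor : ∃ (J : Finset (Fin (r + 1))) (m : Fin (r + 1) → Fin d → ℂ)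
    (F : MvPolynomial (Fin (r + 1) × Fin d) ℂ), J.card = alphaInv V ∧
      m ∈ complexifyTuple (sumKernel V) ∧ MvPolynomial.eval (fun q => m q.1 q.2) F ≠ 0 ∧
      ∀ m' : Fin (r + 1) → Fin d → ℂ, MvPolynomial.eval (fun q => m' q.1 q.2) F ≠ 0 →
        LinearIndependent ℂ fun j : J => m' j := by
  obtain ⟨m, hm, hα⟩ := exists_finrank_eq_alphaInv V
  obtain ⟨J, hJ, hli⟩ := exists_finset_linearIndependent (k := ℚ) m
  have h1 := (linearIndependent_ratCast fun j : J => m j).2 hli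
  obtain ⟨F, hF, hF'⟩ := exists_minor J (fun i l => (m i l : ℂ)) h1
  exact ⟨J, _, F, hJ.trans hα.symm, Submodule.subset_span ⟨m, hm, rfl⟩, hF, hF'⟩

end Alpha

/-! ### Consequences of the spanning hypothesis -/

/-- A linear form constant on `B` kills `B - B`, hence the whole lattice. -/
theorem eq_zero_of_const_on {σ : Type} [Fintype σ] {B : Finset (σ → ℤ)}
    (hspan : AddSubgroup.closure ((B : Set (σ → ℤ)) - (B : Set (σ → ℤ))) = ⊤)
    (μ : σ → ℂ) (x : ℂ) (h : ∀ u ∈ B, ∑ l, μ l * (u l : ℂ) = x) : μ = 0 := by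
  classical
  let g : (σ → ℤ) →+ ℂ :=
    { toFun := fun u => ∑ l, μ l * (u l : ℂ)
      map_zero' := by simp
      map_add' := fun u v => by simp [mul_add, Finset.sum_add_distrib] }
  have h1 : AddSubgroup.closure ((B : Set (σ → ℤ)) - (B : Set (σ → ℤ))) ≤ g.ker := by
    rw [AddSubgroup.closure_le]
    rintro _ ⟨u, hu, v, hv, rfl⟩
    rw [SetLike.mem_coe, AddMonoidHom.mem_ker]
    change g (u - v) = 0
    rw [map_sub, sub_eq_zero]
    exact (h u hu).trans (h v hv).symm
  ext l
  have h2 : (Pi.single l 1 : σ → ℤ) ∈ g.ker := h1 (hspan ▸ AddSubgroup.mem_top _)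
  have h3 : ∑ k, μ k * (((Pi.single l 1 : σ → ℤ) k : ℤ) : ℂ) = 0 := h2
  simpa [Pi.single_apply] using h3

section

variable {d r : ℕ} {A : Fin (r + 1) → Finset (Fin d → ℤ)}

/-- If `A_0` were empty, the sum of the last `r` coordinates would be constantly 1 on the Cayley
sum; if `A_{k+1}` were empty, one of these coordinates would vanish on it. Either contradicts
spanning. -/
theorem nonempty_of_span (hne : (cayleySum A).Nonempty)
    (hspan : AddSubgroup.closure ((cayleySum A : Set (Fin d ⊕ Fin r → ℤ)) -
      (cayleySum A : Set (Fin d ⊕ Fin r → ℤ))) = ⊤) (i : Fin (r + 1)) : (A i).Nonempty := by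
  classical
  by_contra hi
  rw [Finset.not_nonempty_iff_eq_empty] at hi
  have hB : ∀ b ∈ cayleySum A, ∃ j ≠ i, ∃ u, b = cayleyPoint j u := by
    intro b hb
    obtain ⟨j, -, hj⟩ := Finset.mem_biUnion.1 hb
    obtain ⟨u, hu, rfl⟩ := Finset.mem_image.1 hj
    exact ⟨j, by rintro rfl; simp [hi] at hu, u, rfl⟩
  induction i using Fin.cases with
  | zero =>
    have h1 : ∀ b ∈ cayleySum A, ∑ l, (Sum.elim 0 1 : Fin d ⊕ Fin r → ℂ) l * (b l : ℂ) = 1 := by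
      intro b hb
      obtain ⟨j, hj, u, rfl⟩ := hB b hb
      obtain ⟨k, rfl⟩ := Fin.exists_succ_eq.2 hj
      simp [cayleyPoint, Fin.succ_inj]
    have h2 := eq_zero_of_const_on hspan _ 1 h1
    obtain ⟨b, hb⟩ := hne
    have h3 := h1 b hb
    simp [h2] at h3
  | succ k =>
    have h1 := eq_zero_of_const_on hspan (Pi.single (Sum.inr k) 1) 0 fun b hb => by
      obtain ⟨j, hj, u, rfl⟩ := hB b hb
      simp [Pi.single_apply, cayleyPoint, hj]
    have h2 := congrFun h1 (Sum.inr k)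
    simp at h2

/-! ### The contact locus in the fibre torus -/

variable (A) in
/-- The vector with constant coordinate `s_i` on the block of `A_i`. -/
def blockVec : (Fin (r + 1) → ℂ) →ₗ[ℂ] (cayleySum A → ℂ) where
  toFun s b := s ((cayleyEquiv A).symm b).1
  map_add' _ _ := rfl
  map_smul' _ _ := rfl

theorem blockVec_mk (s : Fin (r + 1) → ℂ) (i : Fin (r + 1)) (u : A i) :
    blockVec A s (cayleyMk A ⟨i, u⟩) = s i :=
  congrArg (fun x : Σ i, A i => s x.1) (cayleyEquiv_symm_mk A ⟨i, u⟩)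

theorem blockVec_injective (hA : ∀ i, (A i).Nonempty) : Function.Injective (blockVec A) := by
  intro s s' h
  ext i
  obtain ⟨u, hu⟩ := hA i
  have := congrFun h (cayleyMk A ⟨i, u, hu⟩)
  rwa [blockVec_mk, blockVec_mk] at this

theorem forall_cayleyMk {p : cayleySum A → Prop} (h : ∀ i u, p (cayleyMk A ⟨i, u⟩)) (b) : p b := by
  rw [← cayleyMk_symm A b]
  exact h _ _

/-- The fibre coordinates `(1, t_1, …, t_r)` of a point of the torus. -/
def fibreCoord (t : Fin d ⊕ Fin r → ℂˣ) : Fin (r + 1) → ℂˣ :=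
  Fin.cons 1 fun k => t (Sum.inr k)

theorem monomialVec_mk (t : Fin d ⊕ Fin r → ℂˣ) (i : Fin (r + 1)) (u : A i) :
    monomialVec (cayleySum A) t (cayleyMk A ⟨i, u⟩) =
      ((∏ l, t (Sum.inl l) ^ (u : Fin d → ℤ) l : ℂˣ) : ℂ) * (fibreCoord t i : ℂ) := by
  classical
  rw [monomialVec, ← Units.val_mul]
  congr 1
  rw [Fintype.prod_sum_type]
  congr 1
  induction i using Fin.cases with
  | zero =>
    refine Finset.prod_eq_one fun k _ => ?_
    simp [cayleyMk, cayleyPoint, (Fin.succ_ne_zero k).symm]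
  | succ j =>
    rw [Finset.prod_eq_single j]
    · simp [cayleyMk, cayleyPoint, fibreCoord]
    · intro k _ hk
      simp [cayleyMk, cayleyPoint, hk.symm]
    · simp

theorem monomialVec_eq_blockVec (t : Fin d ⊕ Fin r → ℂˣ) (ht : ∀ l, t (Sum.inl l) = 1) :
    monomialVec (cayleySum A) t = blockVec A fun i => (fibreCoord t i : ℂ) := by
  ext b
  induction b using forall_cayleyMk with
  | h i u =>
    rw [monomialVec_mk, blockVec_mk]
    simp [ht]

variable (hne : (cayleySum A).Nonempty)

theorem mem_openContactLocus_fibre {a : cayleySum A → ℂ} (ha : a ≠ 0) (haL : a ∈ tangentSystem A)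
    (t : Fin d ⊕ Fin r → ℂˣ) (ht : ∀ l, t (Sum.inl l) = 1) :
    t ∈ openContactLocus (cayleySum A) hne (Projectivization.mk ℂ a ha) ↔
      ∑ i, (fibreCoord t i : ℂ) • moments A a i = 0 := by
  rw [← blockScale_mem_tangentSystem A haL]
  have h1 : blockScale A (fun i => (fibreCoord t i : ℂ)) a =
      fun b => a b * monomialVec (cayleySum A) t b := by
    rw [monomialVec_eq_blockVec t ht]
    ext b
    exact mul_comm _ _
  rw [h1, ← forall_embTangent_cayley_iff hne]
  exact isTangentAt_mk _ _ _ _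

/-- The cone over the contact locus lies in the image, under the injective `blockVec`, of the space
`W` of relations `∑ s_i m_i = 0`, and contains the image of every point of `W` without zero
coordinates. Rank-nullity gives `dim W`. -/
theorem coneDim_contact_fibre (hA : ∀ i, (A i).Nonempty) {a : cayleySum A → ℂ} (ha : a ≠ 0)
    (haL : a ∈ tangentSystem A) :
    coneDim (torusMap (cayleySum A) hne ''
      (openContactLocus (cayleySum A) hne (Projectivization.mk ℂ a ha) ∩
        {t | ∀ l : Fin d, t (Sum.inl l) = 1})) +
      Module.finrank ℂ (Submodule.span ℂ (Set.range (moments A a))) = r + 1 := by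
  set E := torusMap (cayleySum A) hne ''
      (openContactLocus (cayleySum A) hne (Projectivization.mk ℂ a ha) ∩
        {t | ∀ l : Fin d, t (Sum.inl l) = 1})
  let W : Submodule ℂ (Fin (r + 1) → ℂ) :=
    LinearMap.ker (Fintype.linearCombination ℂ (moments A a))
  have hW : ∀ s, s ∈ W ↔ ∑ i, s i • moments A a i = 0 := fun s => by
    simp [W, LinearMap.mem_ker, Fintype.linearCombination_apply]
  have hdim : Module.finrank ℂ W +
      Module.finrank ℂ (Submodule.span ℂ (Set.range (moments A a))) = r + 1 := by
    have := LinearMap.finrank_range_add_finrank_ker (Fintype.linearCombination ℂ (moments A a))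
    rw [Fintype.range_linearCombination, Module.finrank_fintype_fun_eq_card, Fintype.card_fin]
      at this
    rw [add_comm]
    exact this
  refine Eq.trans ?_ hdim
  congr 1
  let e := (Module.finBasis ℂ W).equivFun.symm
  let ω : (Fin (Module.finrank ℂ W) → ℂ) →ₗ[ℂ] (Fin (r + 1) → ℂ) := W.subtype.comp e.toLinearMap
  have hω : ∀ s ∈ W, ∃ y, ω y = s := fun s hs => ⟨e.symm ⟨s, hs⟩, by simp [ω]⟩
  have hωW : ∀ y, ω y ∈ W := fun y => (e y).2
  have hcone : ∀ v ∈ affineCone E, ∃ s ∈ W, v = blockVec A s := by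
    intro v hv
    by_cases h0 : v = 0
    · exact ⟨0, zero_mem _, by simp [h0]⟩
    · obtain ⟨t, ⟨ht, ht1⟩, htv⟩ := hv h0
      obtain ⟨c, hc⟩ := (Projectivization.mk_eq_mk_iff' ℂ _ _ _ _).1 htv.symm
      refine ⟨c • fun i => (fibreCoord t i : ℂ), Submodule.smul_mem _ _ ?_, ?_⟩
      · exact (hW _).2 ((mem_openContactLocus_fibre hne ha haL t ht1).1 ht)
      · rw [map_smul, ← monomialVec_eq_blockVec t ht1, hc]
  have hcone' : ∀ s ∈ W, (∀ i, s i ≠ 0) → blockVec A s ∈ affineCone E := by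
    intro s hs hs0
    let t : Fin d ⊕ Fin r → ℂˣ :=
      -- Division by `s 0` normalizes the coordinate of block 0 to 1, as `fibreCoord` requires.
      Sum.elim 1 fun k => Units.mk0 (s k.succ / s 0) (div_ne_zero (hs0 _) (hs0 _))
    have ht1 : ∀ l, t (Sum.inl l) = 1 := fun l => rfl
    have hts : (fun i => (fibreCoord t i : ℂ)) = (s 0)⁻¹ • s := by
      ext i
      induction i using Fin.cases with
      | zero => simp [fibreCoord, hs0]
      | succ k => simp [fibreCoord, t, div_eq_inv_mul]
    have h1 : blockVec A s = s 0 • monomialVec (cayleySum A) t := by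
      rw [monomialVec_eq_blockVec t ht1, hts, map_smul, smul_smul, mul_inv_cancel₀ (hs0 0),
        one_smul]
    rw [h1]
    refine smul_mem_affineCone (fun h => ?_) _
    refine ⟨t, ⟨?_, ht1⟩, rfl⟩
    rw [mem_openContactLocus_fibre hne ha haL t ht1, ← hW, hts]
    exact Submodule.smul_mem _ _ hs
  refine coneDim_eq_of_linear E ((blockVec A).comp ω)
    ((blockVec_injective hA).comp (W.injective_subtype.comp e.injective)) fun F => ?_
  rw [mem_idealOf]
  constructor
  · intro hF
    -- `(1, …, 1) ∈ W`, so the product of the coordinates is not identically zero on `W`, and a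
    -- polynomial vanishing on the torus part of `W` vanishes on all of it.
    obtain ⟨y₁, hy₁⟩ := hω (fun _ => 1) ((hW _).2 (by simpa using haL.2))
    refine eval_eq_zero_of_mul (G := linearPullback ω (∏ i, MvPolynomial.X i)) y₁ ?_ fun y hy => ?_
    · rw [eval_linearPullback, hy₁]
      simp
    · rw [eval_linearPullback, map_prod, Finset.prod_ne_zero_iff] at hy
      rw [eval_linearPullback]
      exact hF _ (hcone' _ (hωW y) fun i h0 =>
        hy i (Finset.mem_univ i) ((MvPolynomial.eval_X i).trans h0))
  · intro hF v hv
    obtain ⟨s, hs, rfl⟩ := hcone v hv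
    obtain ⟨y, rfl⟩ := hω s hs
    rw [← LinearMap.comp_apply, ← eval_linearPullback, hF, map_zero]

theorem holdsGenerally_projDim_contact_fibre (hA : ∀ i, (A i).Nonempty) :
    HoldsGenerally (tangentHyperplanesAtOne (cayleySum A) hne) (fun H =>
      projDim (torusMap (cayleySum A) hne '' (openContactLocus (cayleySum A) hne H ∩
        {t | ∀ l : Fin d, t (Sum.inl l) = 1})) =
          (r : ℤ) - alphaInv fun i => diffSpan (A i)) := by
  obtain ⟨J, m, F, hJ, hm, hFm, hF⟩ := exists_generic_minor fun i => diffSpan (A i)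
  have hspan : ∀ m' : Fin (r + 1) → Fin d → ℂ, m' ∉ tupleZeroLocus (Ideal.span {F}) →
      MvPolynomial.eval (fun q => m' q.1 q.2) F ≠ 0 := by
    intro m' h h0
    apply h
    rw [tupleZeroLocus, Set.mem_ofPred_eq, MvPolynomial.zeroLocus_span]
    simpa [MvPolynomial.aeval_eq_eval] using h0
  obtain ⟨S, hS, hS', hgen⟩ := holdsGenerally_moments hne (Ideal.span {F}) fun hsub =>
    hFm (hsub hm F (Ideal.mem_span_singleton_self F))
  refine ⟨S, hS, hS', fun H hH hHS => ?_⟩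
  obtain ⟨a, ha, rfl, hma⟩ := hgen H hH hHS
  have haL := (mk_mem_tangentHyperplanesAtOne hne a ha).1 hH
  have hK := moments_mem_momentKernel haL
  have hli := hF _ (hspan _ hma)
  have h1 := coneDim_contact_fibre hne hA ha haL
  rw [← span_eq_of_card_eq_alphaInv hK J hJ hli, finrank_span_eq_card hli, Fintype.card_coe,
    hJ] at h1
  rw [projDim]
  omega

end

/-! ### The dual variety and its dimension -/

section Dual

variable {d r : ℕ} {A : Fin (r + 1) → Finset (Fin d → ℤ)}

/-- By the spanning hypothesis the vectors `(1, b)` span a space of dimension `d + r + 1`, and `L`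
is the space of their linear relations. -/
theorem finrank_tangentSystem_add (hne : (cayleySum A).Nonempty)
    (hspan : AddSubgroup.closure ((cayleySum A : Set (Fin d ⊕ Fin r → ℤ)) -
      (cayleySum A : Set (Fin d ⊕ Fin r → ℤ))) = ⊤) :
    Module.finrank ℂ (tangentSystem A) + (d + r + 1) = (cayleySum A).card := by
  classical
  let g : cayleySum A → Option (Fin d ⊕ Fin r) → ℂ :=
    fun b l => l.elim 1 fun k => ((b : Fin d ⊕ Fin r → ℤ) k : ℂ)
  have hker : LinearMap.ker (Fintype.linearCombination ℂ g) = tangentSystem A := by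
    ext a
    rw [LinearMap.mem_ker, mem_tangentSystem_iff, funext_iff, Option.forall,
      Fintype.linearCombination_apply]
    simp only [Finset.sum_apply, Pi.smul_apply, smul_eq_mul, g, Option.elim, Pi.zero_apply,
      mul_one]
  have hrange : LinearMap.range (Fintype.linearCombination ℂ g) = ⊤ := by
    rw [Fintype.range_linearCombination]
    by_contra hlt
    obtain ⟨f, hf, hle⟩ := Submodule.exists_le_ker_of_lt_top _ (lt_top_iff_ne_top.2 hlt)
    apply hf
    have h1 : ∀ b : cayleySum A, f (Pi.single none 1) +
        ∑ l, f (Pi.single (some l) 1) * ((b : Fin d ⊕ Fin r → ℤ) l : ℂ) = 0 := fun b => by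
      have h2 : f (g b) = 0 := hle (Submodule.subset_span ⟨b, rfl⟩)
      rw [linearMap_apply_eq_sum f, Fintype.sum_option] at h2
      simpa [g, mul_comm] using h2
    have h2 := eq_zero_of_const_on hspan (fun l => f (Pi.single (some l) 1))
      (-f (Pi.single none 1)) fun u hu => eq_neg_of_add_eq_zero_right (h1 ⟨u, hu⟩)
    have h3 : f (Pi.single none 1) = 0 := by
      obtain ⟨b, hb⟩ := hne
      have := h1 ⟨b, hb⟩
      simpa only [congrFun h2, Pi.zero_apply, zero_mul, Finset.sum_const_zero, add_zero] using this
    refine LinearMap.ext fun x => ?_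
    rw [linearMap_apply_eq_sum f, Fintype.sum_option, h3]
    simp [congrFun h2]
  have h := LinearMap.finrank_range_add_finrank_ker (Fintype.linearCombination ℂ g)
  rw [hrange, hker, finrank_top, Module.finrank_fintype_fun_eq_card,
    Module.finrank_fintype_fun_eq_card, Fintype.card_option, Fintype.card_sum, Fintype.card_fin,
    Fintype.card_fin, Fintype.card_coe] at h
  omega

/-- Solving `∑ σ_i m_i = 0` for the unknowns with index in `J`, when the `m_j`, `j ∈ J`, form a
basis of the span of the `m_i`. -/
theorem exists_solution_map {n : ℕ} {V : Type} [AddCommGroup V] [Module ℂ V] (m : Fin n → V)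
    (J : Finset (Fin n)) (hli : LinearIndependent ℂ fun j : J => m j)
    (hspan : Submodule.span ℂ (Set.range fun j : J => m j) = Submodule.span ℂ (Set.range m))
    (hsum : ∑ i, m i = 0) :
    ∃ σ : (Fin n → ℂ) →ₗ[ℂ] (Fin n → ℂ), (∀ s, ∀ i ∉ J, σ s i = s i) ∧
      (∀ s, ∑ i, σ s i • m i = 0) ∧ σ 1 = 1 := by
  classical
  let ρ : (J → ℂ) →ₗ[ℂ] V := Fintype.linearCombination ℂ fun j : J => m j
  let Λ : (Fin n → ℂ) →ₗ[ℂ] V := Fintype.linearCombination ℂ m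
  have hρ : Function.Injective ρ := linearIndependent_iff_injective_fintypeLinearCombination.1 hli
  obtain ⟨g, hg⟩ := LinearMap.exists_leftInverse_of_injective ρ (LinearMap.ker_eq_bot.2 hρ)
  have hρg : ∀ s, ρ (g (Λ s)) = Λ s := fun s => by
    have h1 : Λ s ∈ LinearMap.range ρ := by
      rw [Fintype.range_linearCombination, hspan, ← Fintype.range_linearCombination]
      exact ⟨s, rfl⟩
    obtain ⟨x, hx⟩ := h1
    rw [← hx, show g (ρ x) = x from LinearMap.congr_fun hg x]
  let ε : (J → ℂ) →ₗ[ℂ] (Fin n → ℂ) :=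
    { toFun := fun x i => if h : i ∈ J then x ⟨i, h⟩ else 0
      map_add' := fun x y => by ext i; by_cases h : i ∈ J <;> simp [h]
      map_smul' := fun c x => by ext i; by_cases h : i ∈ J <;> simp [h] }
  have hε : ∀ x, Λ (ε x) = ρ x := fun x => by
    simp only [Λ, ρ, Fintype.linearCombination_apply]
    rw [← Finset.sum_subset (Finset.subset_univ J) fun i _ hi => by simp [ε, hi],
      ← Finset.sum_coe_sort J]
    exact Finset.sum_congr rfl fun j _ => by simp [ε]
  -- The value `Λ s = ∑ s_i m_i` is written in the basis `m_j`, `j ∈ J`, and its coefficients are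
  -- subtracted from `s` at the places of `J` only.
  let σ : (Fin n → ℂ) →ₗ[ℂ] (Fin n → ℂ) := LinearMap.id - ε.comp (g.comp Λ)
  have hσ : ∀ s, σ s = s - ε (g (Λ s)) := fun _ => rfl
  refine ⟨σ, fun s i hi => by simp [hσ, ε, hi], fun s => ?_, ?_⟩
  · have : Λ (σ s) = 0 := by rw [hσ, map_sub, hε, hρg, sub_self]
    exact this
  · have : Λ 1 = 0 := by simpa [Λ, Fintype.linearCombination_apply] using hsum
    simp [hσ, this]

/-- Shifting exponents by `w` makes the torus parametrization polynomial. -/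
theorem exists_exponent_bound (B : Finset (Fin d ⊕ Fin r → ℤ)) :
    ∃ w : ℕ, ∀ b ∈ B, ∀ l, 0 ≤ b l + w := by
  refine ⟨∑ b ∈ B, ∑ l, (b l).natAbs, fun b hb l => ?_⟩
  have h1 : (b l).natAbs ≤ ∑ l, (b l).natAbs :=
    Finset.single_le_sum (f := fun l => (b l).natAbs) (fun _ _ => Nat.zero_le _)
      (Finset.mem_univ l)
  have h2 : ∑ l, (b l).natAbs ≤ ∑ b ∈ B, ∑ l, (b l).natAbs :=
    Finset.single_le_sum (f := fun b => ∑ l, (b l).natAbs) (fun _ _ => Nat.zero_le _) hb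
  omega

variable (A) in
/-- A linear parametrization of `tangentSystem A`. -/
def tangentParam : (Fin (Module.finrank ℂ (tangentSystem A)) → ℂ) →ₗ[ℂ] (cayleySum A → ℂ) :=
  (tangentSystem A).subtype.comp (Module.finBasis ℂ (tangentSystem A)).equivFun.symm.toLinearMap

theorem tangentParam_mem (y) : tangentParam A y ∈ tangentSystem A :=
  ((Module.finBasis ℂ (tangentSystem A)).equivFun.symm y).2

theorem exists_tangentParam_eq {a : cayleySum A → ℂ} (ha : a ∈ tangentSystem A) :
    ∃ y, tangentParam A y = a :=
  ⟨(Module.finBasis ℂ (tangentSystem A)).equivFun ⟨a, ha⟩, by simp [tangentParam]⟩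

variable (A) in
/-- Parametrization of the tangent hyperplanes by the base torus, the fibre coordinates with index
in `J`, and the hyperplanes tangent at the unit. -/
def dualParam (J : Finset (Fin (r + 1))) (w : ℕ) (b : cayleySum A) :
    MvPolynomial ((Fin d ⊕ J) ⊕ Fin (Module.finrank ℂ (tangentSystem A))) ℂ :=
  (∏ l : Fin d, MvPolynomial.X (Sum.inl (Sum.inl l)) ^
      ((b : Fin d ⊕ Fin r → ℤ) (Sum.inl l) + w).toNat) *
    (if h : ((cayleyEquiv A).symm b).1 ∈ J then
      MvPolynomial.X (Sum.inl (Sum.inr ⟨((cayleyEquiv A).symm b).1, h⟩)) else 1) *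
    ∑ j, MvPolynomial.C (tangentParam A (Pi.single j 1) b) * MvPolynomial.X (Sum.inr j)

variable (A) in
/-- The character of the base torus attached to a point of the Cayley sum. -/
def baseChar (t : Fin d → ℂˣ) (b : cayleySum A) : ℂ :=
  ((∏ l, t l ^ (b : Fin d ⊕ Fin r → ℤ) (Sum.inl l) : ℂˣ) : ℂ)

theorem eval_dualParam_eq_zero {J : Finset (Fin (r + 1))} {w : ℕ}
    (hw : ∀ b ∈ cayleySum A, ∀ l, 0 ≤ b l + w) {G : MvPolynomial (cayleySum A) ℂ}
    (hG : MvPolynomial.aeval (dualParam A J w) G = 0) (t : Fin d → ℂˣ) (s : Fin (r + 1) → ℂ)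
    (hs : ∀ i ∉ J, s i = 1) {a : cayleySum A → ℂ} (ha : a ∈ tangentSystem A) :
    MvPolynomial.eval (fun b => baseChar A t b * blockScale A s a b) G = 0 := by
  -- The shift by `w` multiplies all coordinates by one common monomial in `t`; it is undone by
  -- rescaling `a` inside the linear space `L`.
  obtain ⟨y, hy⟩ := exists_tangentParam_eq
    (Submodule.smul_mem _ (((∏ l, t l ^ (-(w : ℤ)) : ℂˣ)) : ℂ) ha)
  have h := congrArg (MvPolynomial.eval
    (Sum.elim (Sum.elim (fun l => (t l : ℂ)) (fun j : J => s j)) y)) hG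
  rw [eval_aeval, map_zero] at h
  rw [← h]
  congr 2
  ext b
  have h1 := eval_linearPullback_X (tangentParam A) y b
  simp only [map_sum, map_mul, MvPolynomial.eval_C, MvPolynomial.eval_X] at h1
  simp only [dualParam, map_mul, map_prod, map_pow, MvPolynomial.eval_X, Sum.elim_inl,
    Sum.elim_inr, map_sum, MvPolynomial.eval_C, h1, hy, Pi.smul_apply, smul_eq_mul, blockScale]
  have h2 : MvPolynomial.eval (Sum.elim (Sum.elim (fun l => (t l : ℂ)) (fun j : J => s j)) y)
      (if h : ((cayleyEquiv A).symm b).1 ∈ J then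
        MvPolynomial.X (Sum.inl (Sum.inr ⟨((cayleyEquiv A).symm b).1, h⟩)) else 1) =
      s ((cayleyEquiv A).symm b).1 := by
    split_ifs with h
    · simp
    · simp [hs _ h]
  rw [h2]
  have h3 : (∏ l, (t l : ℂ) ^ ((b : Fin d ⊕ Fin r → ℤ) (Sum.inl l) + w).toNat) *
      (((∏ l, t l ^ (-(w : ℤ)) : ℂˣ)) : ℂ) = baseChar A t b := by
    rw [baseChar, Units.coe_prod, Units.coe_prod, ← Finset.prod_mul_distrib]
    refine Finset.prod_congr rfl fun l _ => ?_
    rw [Units.val_zpow_eq_zpow_val, Units.val_zpow_eq_zpow_val, ← zpow_natCast,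
      ← zpow_add₀ (t l).ne_zero, Int.toNat_of_nonneg (hw b b.2 _)]
    congr 1
    omega
  rw [← h3]
  ring

/-- Scalars off `J` are redundant. If the `m_j`, `j ∈ J`, are independent, take `σ` with `∑ σ_i m_i
= 0` and `σ_i = s_i` off `J`. Then `s·a = (s/σ)·(σ·a)`, where `σ·a` is again in `L` and `s/σ` is 1
off `J`, a case covered by the parametrization. Both independence and `σ_j ≠ 0` on `J` can be tested
by nonzero polynomials, so the vanishing extends to all `s` and `a`. -/
theorem eval_baseChar_blockScale_eq_zero {J : Finset (Fin (r + 1))} {w : ℕ}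
    (hw : ∀ b ∈ cayleySum A, ∀ l, 0 ≤ b l + w) (hJ : J.card = alphaInv fun i => diffSpan (A i))
    {m : Fin (r + 1) → Fin d → ℂ} (hm : m ∈ momentKernel A)
    {F : MvPolynomial (Fin (r + 1) × Fin d) ℂ} (hFm : MvPolynomial.eval (fun q => m q.1 q.2) F ≠ 0)
    (hF : ∀ m' : Fin (r + 1) → Fin d → ℂ, MvPolynomial.eval (fun q => m' q.1 q.2) F ≠ 0 →
      LinearIndependent ℂ fun j : J => m' j)
    {G : MvPolynomial (cayleySum A) ℂ} (hG : MvPolynomial.aeval (dualParam A J w) G = 0)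
    (t : Fin d → ℂˣ) (s : Fin (r + 1) → ℂ) {a : cayleySum A → ℂ} (ha : a ∈ tangentSystem A) :
    MvPolynomial.eval (fun b => baseChar A t b * blockScale A s a b) G = 0 := by
  have hgood : ∀ a ∈ tangentSystem A, (LinearIndependent ℂ fun j : J => moments A a j) →
      ∀ s, MvPolynomial.eval (fun b => baseChar A t b * blockScale A s a b) G = 0 := by
    intro a ha hli s
    have hK := moments_mem_momentKernel ha
    obtain ⟨σ, hσJ, hσ, hσ1⟩ := exists_solution_map (moments A a) J hli
      (span_eq_of_card_eq_alphaInv hK J hJ hli) ha.2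
    let ψ : (Fin (r + 1) → ℂ) →ₗ[ℂ] (cayleySum A → ℂ) :=
      { toFun := fun s b => baseChar A t b * blockScale A s a b
        map_add' := fun s s' => by ext b; simp [blockScale]; ring
        map_smul' := fun c s => by ext b; simp [blockScale]; ring }
    have h0 : linearPullback ψ G = 0 := by
      -- The product of the `σ_j` is a nonzero polynomial in `s`, since `σ 1 = 1`.
      refine eval_eq_zero_of_mul (G := linearPullback σ (∏ j ∈ J, MvPolynomial.X j)) 1 ?_
        fun s hs => ?_
      · rw [eval_linearPullback, hσ1]
        simp
      · rw [eval_linearPullback, map_prod, Finset.prod_ne_zero_iff] at hs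
        have hs' : ∀ j ∈ J, σ s j ≠ 0 := fun j hj => by simpa using hs j hj
        have h1 := eval_dualParam_eq_zero hw hG t (fun i => if i ∈ J then s i / σ s i else 1)
          (fun i hi => by simp [hi]) ((blockScale_mem_tangentSystem A ha _).2 (hσ s))
        rw [eval_linearPullback, ← h1]
        congr 2
        ext b
        change baseChar A t b * blockScale A s a b = _
        simp only [blockScale]
        split_ifs with h
        · rw [← mul_assoc (s _ / _), div_mul_cancel₀ _ (hs' _ h)]
        · rw [hσJ s _ h, one_mul]
    have h2 := eval_linearPullback ψ G s
    rw [h0, map_zero] at h2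
    exact h2.symm
  let ψ : (cayleySum A → ℂ) →ₗ[ℂ] (cayleySum A → ℂ) :=
    { toFun := fun a b => baseChar A t b * blockScale A s a b
      map_add' := fun a a' => by ext b; simp [blockScale]; ring
      map_smul' := fun c a => by ext b; simp [blockScale]; ring }
  have h0 : linearPullback (ψ.comp (tangentParam A)) G = 0 := by
    obtain ⟨a₁, ha₁, rfl⟩ := exists_moments_eq hm
    obtain ⟨y₁, rfl⟩ := exists_tangentParam_eq ha₁
    refine eval_eq_zero_of_mul (G := linearPullback (tangentParam A) (momentsPullback F)) y₁ ?_
      fun y hy => ?_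
    · rwa [eval_linearPullback, eval_momentsPullback]
    · rw [eval_linearPullback, eval_momentsPullback] at hy
      rw [eval_linearPullback]
      exact hgood _ (tangentParam_mem y) (hF _ hy) s
  obtain ⟨y, rfl⟩ := exists_tangentParam_eq ha
  have h2 := eval_linearPullback (ψ.comp (tangentParam A)) G y
  rw [h0, map_zero] at h2
  exact h2.symm

/-- A polynomial vanishing on the equations of all hyperplanes tangent at points of the torus
vanishes on the equations of all tangent hyperplanes. -/
theorem mem_idealOf_tangent (hne : (cayleySum A).Nonempty) {G : MvPolynomial (cayleySum A) ℂ}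
    (hG : ∀ (t : Fin d ⊕ Fin r → ℂˣ) (a : cayleySum A → ℂ),
      (fun b => a b * monomialVec (cayleySum A) t b) ∈ tangentSystem A →
        MvPolynomial.eval a G = 0) :
    G ∈ idealOf {H | ∃ P, IsSmoothPoint (toricVariety (cayleySum A) hne) P ∧
      IsTangentAt (toricVariety (cayleySum A) hne) H P} := by
  rw [mem_idealOf]
  intro v hv
  by_cases h0 : v = 0
  · exact hG 1 v (by
      have : (fun b => v b * monomialVec (cayleySum A) 1 b) = 0 := by
        ext b
        simp [h0]
      rw [this]
      exact zero_mem _)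
  obtain ⟨P, hP, hvP⟩ := hv h0
  rw [isTangentAt_mk] at hvP
  obtain ⟨F, hF, hFv⟩ := exists_grad_eq _ P v hvP
  obtain ⟨i, hi⟩ := exists_ne_zero_apply P.rep_nonzero
  -- At torus points the gradient of `F` is the equation of a tangent hyperplane (or zero), so
  -- `G(∇F)` vanishes there and hence on the closure, in particular at `P`. Smoothness of `P` plays
  -- no role; `X i` again handles the origin.
  have h1 : MvPolynomial.X i * MvPolynomial.aeval (fun b => MvPolynomial.pderiv b F) G ∈
      idealOf (Set.range (torusMap (cayleySum A) hne)) := by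
    rw [mem_idealOf]
    intro p hp
    by_cases hp0 : p = 0
    · simp [hp0]
    obtain ⟨t, ht⟩ := hp hp0
    rw [map_mul, eval_aeval, hG t, mul_zero]
    rw [← forall_embTangent_cayley_iff hne, ht]
    intro w hw
    exact (mem_embTangent_mk _ p hp0 w).1 hw F hF
  have h2 := mem_zariskiClosure.1 hP.1 _ h1
  rw [map_mul, MvPolynomial.eval_X, mul_eq_zero, or_iff_right hi, eval_aeval] at h2
  rw [← h2]
  congr 2
  ext b
  exact hFv b

theorem coneDim_zariskiClosure {ι : Type} (S : Set (ProjSpace ι)) :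
    coneDim (zariskiClosure S) = coneDim S := by
  rw [coneDim, coneDim, idealOf_zariskiClosure]

theorem coneDim_dualVariety_le (hne : (cayleySum A).Nonempty) :
    coneDim (dualVariety (toricVariety (cayleySum A) hne)) ≤
      d + alphaInv (fun i => diffSpan (A i)) + Module.finrank ℂ (tangentSystem A) := by
  obtain ⟨J, m, F, hJ, hm, hFm, hF⟩ := exists_generic_minor fun i => diffSpan (A i)
  obtain ⟨w, hw⟩ := exists_exponent_bound (cayleySum A)
  rw [dualVariety, coneDim_zariskiClosure]
  refine (coneDim_le_of_ker_le _ (MvPolynomial.aeval (dualParam A J w)) fun G hG =>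
    mem_idealOf_tangent hne fun t a ha => ?_).trans_eq ?_
  -- Tangency at `t` puts `(a_b t^b)` in `L`, so `a` is recovered from an element of `L` by the
  -- inverse translation.
  · have h1 := eval_baseChar_blockScale_eq_zero hw hJ hm hFm hF hG
      (fun l => (t (Sum.inl l))⁻¹) (fun i => ((fibreCoord t i)⁻¹ : ℂˣ)) ha
    rw [← h1]
    congr 2
    ext b
    induction b using forall_cayleyMk with
    | h i u =>
      rw [blockScale_mk, monomialVec_mk, baseChar]
      simp only [inv_zpow, Finset.prod_inv_distrib, Units.val_inv_eq_inv_val]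
      have h3 : ∀ x y : ℂˣ, ∀ z : ℂ, z = (x : ℂ)⁻¹ * ((y : ℂ)⁻¹ * (z * (x * y))) := fun x y z => by
        have := x.ne_zero
        have := y.ne_zero
        field_simp
      exact h3 _ _ _
  · simp [hJ]

theorem le_dualDefect (hne : (cayleySum A).Nonempty)
    (hspan : AddSubgroup.closure ((cayleySum A : Set (Fin d ⊕ Fin r → ℤ)) -
      (cayleySum A : Set (Fin d ⊕ Fin r → ℤ))) = ⊤) :
    (r : ℤ) - alphaInv (fun i => diffSpan (A i)) ≤
      dualDefect (toricVariety (cayleySum A) hne) := by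
  have h1 := coneDim_dualVariety_le hne
  have h2 := finrank_tangentSystem_add hne hspan
  rw [dualDefect, projDim, Fintype.card_coe]
  omega

end Dual

/-! ### Projections to Cayley sums of join type -/

section Join

variable {d r : ℕ}

theorem exists_int_multiple_of_mem_diffSpan (B : Finset (Fin d → ℤ)) {w : Fin d → ℚ}
    (hw : w ∈ diffSpan B) : ∃ D : ℤ, D ≠ 0 ∧
      ∃ z ∈ AddSubgroup.closure ((B : Set (Fin d → ℤ)) - (B : Set (Fin d → ℤ))),
        ∀ l, (z l : ℚ) = D * w l := by
  induction hw using Submodule.span_induction with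
  | mem x hx =>
    obtain ⟨u, hu, v, hv, rfl⟩ := hx
    exact ⟨1, one_ne_zero, u - v, AddSubgroup.subset_closure ⟨u, hu, v, hv, rfl⟩, fun l => by simp⟩
  | zero => exact ⟨1, one_ne_zero, 0, zero_mem _, by simp⟩
  | add x y _ _ hx hy =>
    obtain ⟨D, hD, z, hz, h⟩ := hx
    obtain ⟨D', hD', z', hz', h'⟩ := hy
    refine ⟨D * D', mul_ne_zero hD hD', D' • z + D • z',
      add_mem (zsmul_mem hz _) (zsmul_mem hz' _), fun l => ?_⟩
    simp [h, h']
    ring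
  | smul c x _ hx =>
    obtain ⟨D, hD, z, hz, h⟩ := hx
    refine ⟨D * c.den, mul_ne_zero hD (by exact_mod_cast c.den_ne_zero), c.num • z,
      zsmul_mem hz _, fun l => ?_⟩
    have hc : (c.num : ℚ) = c * c.den := (Rat.mul_den_eq_num c).symm
    simp only [Pi.smul_apply, smul_eq_mul, Int.cast_mul, Int.cast_natCast, h]
    rw [hc]
    ring

theorem exists_common_int_multiple (A : Fin (r + 1) → Finset (Fin d → ℤ))
    {m : Fin (r + 1) → Fin d → ℚ} (hm : ∀ i, m i ∈ diffSpan (A i)) : ∃ D : ℤ, D ≠ 0 ∧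
      ∃ z : Fin (r + 1) → Fin d → ℤ,
        (∀ i, z i ∈ AddSubgroup.closure ((A i : Set (Fin d → ℤ)) - (A i : Set (Fin d → ℤ)))) ∧
        ∀ i l, (z i l : ℚ) = D * m i l := by
  choose D hD z hz h using fun i => exists_int_multiple_of_mem_diffSpan (A i) (hm i)
  refine ⟨∏ i, D i, Finset.prod_ne_zero_iff.2 fun i _ => hD i,
    fun i => (∏ j ∈ Finset.univ.erase i, D j) • z i, fun i => zsmul_mem (hz i) _, fun i l => ?_⟩
  rw [← Finset.prod_erase_mul _ _ (Finset.mem_univ i)]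
  simp [h, mul_assoc]

/-- A maximizing tuple is scaled to integer vectors `z_i` in the groups `⟨A_i - A_i⟩`. The `p(z_i)`
sum to zero in a direct sum, so each vanishes, and the span of the tuple lies in the kernel of `pQ`,
of dimension `c`. -/
theorem alphaInv_le_of_isJoinType (A : Fin (r + 1) → Finset (Fin d → ℤ)) (c e : ℕ)
    (p : (Fin d → ℤ) →+ (Fin e → ℤ)) (hde : d = e + c) (hp : Function.Surjective p)
    (hjoin : IsJoinType fun i => (A i).image p) :
    alphaInv (fun i => diffSpan (A i)) ≤ c := by
  obtain ⟨m, hm, hα⟩ := exists_finrank_eq_alphaInv fun i => diffSpan (A i)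
  let pQ : (Fin d → ℚ) →ₗ[ℚ] (Fin e → ℚ) :=
    Fintype.linearCombination ℚ fun l j => (p (Pi.single l 1) j : ℚ)
  have hpQ : ∀ z : Fin d → ℤ, pQ (fun l => (z l : ℚ)) = fun j => (p z j : ℚ) := fun z => by
    have h1 : p z = ∑ l, z l • p (Pi.single l 1) := linearMap_apply_eq_sum p.toIntLinearMap z
    ext j
    rw [h1]
    simp [pQ, Fintype.linearCombination_apply, Finset.sum_apply]
  have hsurj : LinearMap.range pQ = ⊤ := by
    rw [eq_top_iff]
    intro y _
    rw [← Finset.univ_sum_single y]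
    refine sum_mem fun j _ => ?_
    obtain ⟨z, hz⟩ := hp (Pi.single j 1)
    refine ⟨y j • fun l => (z l : ℚ), ?_⟩
    rw [map_smul, hpQ, hz]
    ext k
    by_cases hk : k = j
    · subst hk
      simp
    · simp [hk]
  have hker : Module.finrank ℚ (LinearMap.ker pQ) = c := by
    have := LinearMap.finrank_range_add_finrank_ker pQ
    rw [hsurj, finrank_top, Module.finrank_fintype_fun_eq_card, Module.finrank_fintype_fun_eq_card,
      Fintype.card_fin, Fintype.card_fin] at this
    omega
  obtain ⟨D, hD, z, hz, hzm⟩ := exists_common_int_multiple A hm.1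
  have hzsum : ∑ i, z i = 0 := by
    ext l
    have h1 : ∑ i, m i l = 0 := by simpa using congrFun hm.2 l
    have h2 : ((∑ i, z i l : ℤ) : ℚ) = 0 := by
      push_cast
      simp only [hzm, ← Finset.mul_sum, h1, mul_zero]
    simpa using (by exact_mod_cast h2 : ∑ i, z i l = 0)
  have hpz : ∀ i, p (z i) ∈ AddSubgroup.closure
      (((A i).image p : Set (Fin e → ℤ)) - ((A i).image p : Set (Fin e → ℤ))) := fun i => by
    rw [Finset.coe_image, ← Set.image_sub, ← AddMonoidHom.map_closure]
    exact AddSubgroup.mem_map_of_mem p (hz i)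
  have hzero := @hjoin (fun i => ⟨p (z i), hpz i⟩) 0 (by
    change ∑ i, p (z i) = ∑ i : Fin (r + 1), (0 : Fin e → ℤ)
    rw [← map_sum, hzsum]
    simp)
  rw [hα, ← hker]
  refine Submodule.finrank_mono (Submodule.span_le.2 ?_)
  rintro _ ⟨i, rfl⟩
  have h1 : p (z i) = 0 := congrArg Subtype.val (congrFun hzero i)
  have h2 : (fun l => (z i l : ℚ)) = (D : ℚ) • m i := by
    ext l
    simp [hzm]
  have h3 := hpQ (z i)
  rw [h1, h2, map_smul] at h3
  have h4 : (D : ℚ) • pQ (m i) = 0 := by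
    rw [h3]
    ext
    simp
  exact (smul_eq_zero.1 h4).resolve_left (by exact_mod_cast hD)

end Join

end CayleyContact

end

/-! ### The contact locus theorem for Cayley sums. -/

theorem mainTheorem6 (d r : ℕ) (A : Fin (r + 1) → Finset (Fin d → ℤ))
    (hne : (CayleyContact.cayleySum A).Nonempty)
    (hspan : AddSubgroup.closure
      ((CayleyContact.cayleySum A : Set (Fin d ⊕ Fin r → ℤ)) -
        (CayleyContact.cayleySum A : Set (Fin d ⊕ Fin r → ℤ))) = ⊤) :
    -- (i) `m_i ∈ (V_i)_ℂ` and `(m_0, …, m_r) ∈ K_ℂ` whenever `[a]` is tangent at the unit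
    (∀ (a : CayleyContact.cayleySum A → ℂ) (ha : a ≠ 0),
      Projectivization.mk ℂ a ha ∈
          CayleyContact.tangentHyperplanesAtOne (CayleyContact.cayleySum A) hne →
        (∀ i, CayleyContact.moments A a i ∈
          CayleyContact.complexify (CayleyContact.diffSpan (A i))) ∧
        CayleyContact.moments A a ∈ CayleyContact.complexifyTuple
          (CayleyContact.sumKernel fun i => CayleyContact.diffSpan (A i))) ∧
    -- (ii) `(m_0, …, m_r)` is general in `K_ℂ` for general `H`: it avoids any given proper
    -- algebraic subset of `K_ℂ`, for a general coefficient vector, and for a suitable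
    -- equation of a general hyperplane
    (∀ I : Ideal (MvPolynomial (Fin (r + 1) × Fin d) ℂ),
      (¬ (CayleyContact.complexifyTuple
          (CayleyContact.sumKernel fun i => CayleyContact.diffSpan (A i)) :
            Set (Fin (r + 1) → Fin d → ℂ)) ⊆ CayleyContact.tupleZeroLocus I) →
        (∃ J : Ideal (MvPolynomial (CayleyContact.cayleySum A) ℂ),
          (¬ CayleyContact.affineCone
              (CayleyContact.tangentHyperplanesAtOne (CayleyContact.cayleySum A) hne) ⊆
            MvPolynomial.zeroLocus ℂ J) ∧
          ∀ a ∈ CayleyContact.affineCone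
              (CayleyContact.tangentHyperplanesAtOne (CayleyContact.cayleySum A) hne),
            a ∉ MvPolynomial.zeroLocus ℂ J →
              CayleyContact.moments A a ∉ CayleyContact.tupleZeroLocus I) ∧
        CayleyContact.HoldsGenerally
          (CayleyContact.tangentHyperplanesAtOne (CayleyContact.cayleySum A) hne)
          (fun H => ∃ (a : CayleyContact.cayleySum A → ℂ) (ha : a ≠ 0),
            Projectivization.mk ℂ a ha = H ∧
              CayleyContact.moments A a ∉ CayleyContact.tupleZeroLocus I)) ∧
    -- (iii) the dimension of `Z°_{A,H} ∩ ({1} × (ℂ^×)^r)` for general `H`, and the bound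
    CayleyContact.HoldsGenerally
      (CayleyContact.tangentHyperplanesAtOne (CayleyContact.cayleySum A) hne)
      (fun H =>
        CayleyContact.projDim (CayleyContact.torusMap (CayleyContact.cayleySum A) hne ''
            (CayleyContact.openContactLocus (CayleyContact.cayleySum A) hne H ∩
              {t | ∀ l : Fin d, t (Sum.inl l) = 1})) =
          (r : ℤ) - CayleyContact.alphaInv fun i => CayleyContact.diffSpan (A i)) ∧
    (r : ℤ) - CayleyContact.alphaInv (fun i => CayleyContact.diffSpan (A i)) ≤
      CayleyContact.dualDefect (CayleyContact.toricVariety (CayleyContact.cayleySum A) hne) ∧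
    -- (iv)
    (∀ (c e : ℕ) (p : (Fin d → ℤ) →+ (Fin e → ℤ)), d = e + c → Function.Surjective p →
      CayleyContact.IsJoinType (fun i => (A i).image p) →
        CayleyContact.alphaInv (fun i => CayleyContact.diffSpan (A i)) ≤ c ∧
        (r : ℤ) - c ≤
          CayleyContact.dualDefect
            (CayleyContact.toricVariety (CayleyContact.cayleySum A) hne)) := by
  have hA := CayleyContact.nonempty_of_span hne hspan
  refine ⟨fun a ha h => ?_, fun I hI => ⟨CayleyContact.exists_ideal_moments hne I hI,
    CayleyContact.holdsGenerally_moments hne I hI⟩,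
    CayleyContact.holdsGenerally_projDim_contact_fibre hne hA,
    CayleyContact.le_dualDefect hne hspan, fun c e p hde hp hjoin => ?_⟩
  · have hK := CayleyContact.moments_mem_momentKernel
      ((CayleyContact.mk_mem_tangentHyperplanesAtOne hne a ha).1 h)
    exact ⟨CayleyContact.apply_mem_complexify hK, hK⟩
  · have h1 := CayleyContact.alphaInv_le_of_isJoinType A c e p hde hp hjoin
    have h2 := CayleyContact.le_dualDefect hne hspan
    exact ⟨h1, by omega⟩
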